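/- **Theorem 1 (lower bound).** *Factorizations.* An LZ77-type factorization of a string $X=X[1..n]$ over the alphabet $[0..\sigma)$ partitions $X$ from left to right into literal phrases, each representing one symbol, and repeat phrases $(p,\ell)$; a repeat phrase starting at position $i$ represents $X[i..i+\ell)$, where $p<i$, $\ell\ge 1$ and $X[p..p+\ell)=X[i..i+\ell)$. The number of repeat phrases is $O(n/\log_\sigma n)$. *Model.* We use the external memory model with RAM size $M$ and disk block size $B$, both measured in words of $\Theta(\log n)$ bits, where $1\le B\le M/2$. Symbols are indivisible records of $\log\sigma$ bits, so that a block holds at most $\Theta(B\log_\sigma n)$ symbols and the RAM at most $\Theta(M\log_\sigma n)$. One I/O moves a block between disk and RAM. Inside the RAM, symbols may be copied, permuted and discarded for free. The literal symbols of the factorization are stored in order in consecutive input blocks on disk, and the RAM is initially empty. To decode the factorization is to write $X$ to consecutive blocks behind the input. The sequence of operations may depend on the whole factorization, and source positions, lengths and all other data that are not symbols can be stored and used for free; but the same sequence of operations must recover the right string whatever symbols are put in place of those of the literal phrases. *Claim.* Let $2\le\sigma=n^{O(1)}$ and assume $B\log(M/B)=\Omega(\log(n/B))$. Then in the worst case decoding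 an LZ77-type factorization of a string of length $n$ over an alphabet of size $\sigma$ needs $$\Omega\left(\frac{n}{B\log_\sigma n}\,\log_{M/B}\frac{n}{B\log_\sigma n}\right)$$ I/Os. Precisely: for all constants $\omega,a,C,\beta>0$ there are $c>0$ and $n_0$ such that for all $n\ge n_0$, $2\le\sigma\le n^a$, $B\ge1$ and $M\ge 2B$ with $B\log(M/B)\ge\beta\log(n/B)$ there is a factorization of a string of length $n$ over $[0..\sigma)$, with at most $Cn/\log_\sigma n$ repeat phrases, such that every sequence of operations that decodes it, with words of $\omega\log n$ bits, uses at least $c\,\frac{n}{B\log_\sigma n}\log_{M/B}\frac{n}{B\log_\sigma n}$ I/Os. -/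

import Mathlib

namespace LZDecoding

/-! ### Strings and LZ77-type factorizations

Strings are lists; positions are counted from `0`. -/

/-- A phrase of an LZ77-type factorization: a literal phrase carries one symbol, a repeat phrase
carries the starting position `p` of its source and its length `l`. -/
inductive Phrase (α : Type) where
  | literal (c : α) : Phrase α
  | rep (p l : ℕ) : Phrase α

/-- A phrase with its symbol erased: what remains is the phrase type and, for a repeat phrase,
the source position and the length. -/
def Phrase.shape {α : Type} : Phrase α → Phrase Unit
  | .literal _ => .literal ()
  | .rep p l => .rep p l

/-- The symbols of the literal phrases, from left to right. -/
def literals {α : Type} : List (Phrase α) → List α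
  | [] => []
  | .literal c :: F => c :: literals F
  | .rep _ _ :: F => literals F

/-- The number of repeat phrases. -/
def numRep {α : Type} : List (Phrase α) → ℕ
  | [] => 0
  | .literal _ :: F => numRep F
  | .rep _ _ :: F => numRep F + 1

/-- `ParsesFrom X i F`: the phrases `F` partition the suffix of `X` that starts at position `i`.
A literal phrase represents the single symbol at its position. A repeat phrase `(p, l)` at
position `i` represents the nonempty substring `X[i..i+l)`, which also occurs at the earlier
position `p < i` (source and phrase may overlap). -/
def ParsesFrom {α : Type} (X : List α) : ℕ → List (Phrase α) → Prop
  | i, [] => i = X.length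
  | i, .literal c :: F => X[i]? = some c ∧ ParsesFrom X (i + 1) F
  | i, .rep p l :: F =>
      (p < i ∧ 1 ≤ l ∧ i + l ≤ X.length ∧ ∀ k < l, X[p + k]? = X[i + k]?) ∧
        ParsesFrom X (i + l) F

/-- `F` is a factorization of the string `X` into literal and repeat phrases. -/
def IsFactorization {α : Type} (F : List (Phrase α)) (X : List α) : Prop :=
  ParsesFrom X 0 F

/-- `F` is an LZ77-type factorization of the string `X` of length `n` over the alphabet
`[0..σ)`, where `C` is the constant in the bound `z_rep = O(n / log_σ n)`. -/
def IsLZ77Type (C : ℝ) (n σ : ℕ) (F : List (Phrase (Fin σ))) (X : List (Fin σ)) : Prop :=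
  X.length = n ∧ IsFactorization F X ∧ (numRep F : ℝ) ≤ C * (n / Real.logb σ n)

/-! ### The external memory model

A RAM that holds at most `m` symbols and an unbounded disk made of blocks of at most `b` symbols.
Symbols are indivisible records: they are moved, copied and discarded. Work inside the RAM is
free, and so are the choice of the operations and all storage for data other than text symbols
(such as source positions and lengths). -/

/-- Contents of the RAM and of the disk blocks. -/
structure Config (α : Type) where
  ram : List α
  disk : ℕ → List α

/-- Operations. `s` lists the RAM positions that are selected, in any order and possibly
with repetitions; positions that are not in use are ignored. -/
inductive Op where
  /-- transfer (a copy of) disk block `i` into the RAM -/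
  | read (i : ℕ) : Op
  /-- overwrite disk block `i` with the selected RAM symbols -/
  | write (i : ℕ) (s : List ℕ) : Op
  /-- replace the RAM contents by the selected RAM symbols -/
  | compute (s : List ℕ) : Op

/-- The symbols of `r` at the positions listed in `s`. -/
def select {α : Type} (r : List α) (s : List ℕ) : List α :=
  s.filterMap fun k => r[k]?

/-- One operation; it fails if the capacity `m` of the RAM or `b` of a block is exceeded. -/
def step {α : Type} (m b : ℕ) (c : Config α) : Op → Option (Config α)
  | .read i =>
      if (c.ram ++ c.disk i).length ≤ m then some ⟨c.ram ++ c.disk i, c.disk⟩ else none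
  | .write i s =>
      if (select c.ram s).length ≤ b then
        some ⟨c.ram, Function.update c.disk i (select c.ram s)⟩
      else none
  | .compute s =>
      if (select c.ram s).length ≤ m then some ⟨select c.ram s, c.disk⟩ else none

/-- Execution of a sequence of operations. -/
def run {α : Type} (m b : ℕ) : List Op → Config α → Option (Config α)
  | [], c => some c
  | o :: os, c => (step m b c o).bind (run m b os)

/-- A program: the operations to perform, and the place of the output, which consists of the
`outLen` consecutive disk blocks that start at block `outStart`. -/
structure Program where
  ops : List Op
  outStart : ℕ
  outLen : ℕ

/-- The number of blocks moved between RAM and disk by a sequence of operations. -/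
def ioCount : List Op → ℕ
  | [] => 0
  | .read _ :: os => ioCount os + 1
  | .write _ _ :: os => ioCount os + 1
  | .compute _ :: os => ioCount os

/-- The string stored in the output blocks. -/
def Program.output {α : Type} (P : Program) (c : Config α) : List α :=
  (List.range P.outLen).flatMap fun j => c.disk (P.outStart + j)

/-- Start of a computation: empty RAM, and the input blocks `D` at the beginning of the disk. -/
def initial {α : Type} (D : List (List α)) : Config α :=
  ⟨[], fun i => D.getD i []⟩

/-- `L` lists how many literal symbols each input block holds, when the factorization `F` is
stored phrase by phrase in consecutive blocks of capacity `b`. (A block need not be full of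
symbols, since it may also hold other data.) -/
def IsLayout {α : Type} (b : ℕ) (F : List (Phrase α)) (L : List ℕ) : Prop :=
  (∀ k ∈ L, k ≤ b) ∧ L.sum = (literals F).length

/-- `P` decodes the factorization `F` that is stored with layout `L`. The program may be chosen
with full knowledge of `F`, but it treats the literal symbols as uninterpreted records: whatever
these symbols are, it recovers the string. The output is written behind the input. -/
def Decodes {α : Type} (m b : ℕ) (P : Program) (F : List (Phrase α)) (L : List ℕ) : Prop :=
  L.length ≤ P.outStart ∧
    ∀ (F' : List (Phrase α)) (X' : List α),
      F'.map Phrase.shape = F.map Phrase.shape → IsFactorization F' X' →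
      ∀ D : List (List α), D.map List.length = L → D.flatten = literals F' →
        ∃ c, run m b P.ops (initial D) = some c ∧ P.output c = X'

/-- The number of symbols over the alphabet `[0..σ)`, of `log σ` bits each, that fit into `k`
words of `ω * log n` bits each. -/
noncomputable def symbolCapacity (ω : ℝ) (n σ k : ℕ) : ℕ :=
  ⌊k * (ω * Real.logb σ n)⌋₊

end LZDecoding

namespace LZDecoding

/-! ### Operations do not look at the symbols -/

/-! The hard strings consist of `K` chunks of `l`, about `(log_σ n) / C`, literals, then the same
chunks in an arbitrary order `π`, each copied by one repeat phrase, then literals that fill up the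
length. A decoder must in effect permute `K` records of about one word each, and the bound is the
classical counting bound for permuting in external memory.

Decoders never inspect symbols, so they can be run on labels, the indices of the literals
(`run_map`, `exists_run_labels`). The obstacle is that symbols, not chunks, are the indivisible
units: a chunk may be torn apart. The remedy is to track only the labels in one residue class modulo
`l`. Every chunk has exactly one of them, and by averaging (`exists_residue_le`) some class uses
only an `O(1/l)` fraction of the RAM and block capacities over `T` I/Os, that is, `O(M)` and `O(B)`
labels per I/O on average.

Given the I/O addresses, the movement of the tracked labels is determined by bits telling which
labels are discarded or written (`exists_bits_replay`): `O(TM)` bits with only `O(TB)` ones, hence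
`exp(O(TB log(M/B)))` possibilities. The addresses and block boundaries contribute `n^O(T)`, which
the condition on `B` and `M` makes no larger (`log_le_mul_of_le`). All this fixes the tracked labels
in every output block, and so leaves `O(B)` candidates for each repeated chunk (`exists_code`).
Therefore `K! ≤ exp(O(TB log(M/B))) * O(B)^K` (`factorial_le_of_decodes`), and logarithms give the
claim. If `n / (B log_σ n)` is bounded, counting says nothing, but then the cost of writing the
output suffices (`le_mul_ioCount`). -/

/-- Apply `f` to every symbol of a configuration. -/
def Config.map {α β : Type} (f : α → β) (c : Config α) : Config β :=
  ⟨c.ram.map f, fun i => (c.disk i).map f⟩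

theorem select_map {α β : Type} (f : α → β) (r : List α) (s : List ℕ) :
    select (r.map f) s = (select r s).map f := by
  induction s with
  | nil => simp [select]
  | cons k s ih =>
    simp only [select, List.filterMap_cons, List.getElem?_map] at ih ⊢
    cases r[k]? <;> simp [ih]

theorem mem_of_mem_select {α : Type} {r : List α} {s : List ℕ} {x : α} (h : x ∈ select r s) :
    x ∈ r := by
  obtain ⟨k, -, hk⟩ := List.mem_filterMap.1 h
  exact List.mem_of_getElem? hk

theorem step_map {α β : Type} (f : α → β) (m b : ℕ) (c : Config α) (o : Op) :
    step m b (c.map f) o = (step m b c o).map (Config.map f) := by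
  cases o with
  | read i =>
    simp only [step, Config.map, ← List.map_append, List.length_map]
    split_ifs <;> simp [Config.map]
  | write i s =>
    simp only [step, Config.map, select_map, List.length_map]
    split_ifs
    · simp only [Option.map_some, Config.map, Option.some.injEq, Config.mk.injEq, true_and]
      funext j
      by_cases h : j = i
      · subst h; simp
      · simp [Function.update_of_ne h]
    · rfl
  | compute s =>
    simp only [step, Config.map, select_map, List.length_map]
    split_ifs <;> simp [Config.map]

/-- Naturality in the symbols: success and all movements depend on lengths and positions only. This
is what transfers a run on symbols to a run on labels. -/
theorem run_map {α β : Type} (f : α → β) (m b : ℕ) (os : List Op) (c : Config α) :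
    run m b os (c.map f) = (run m b os c).map (Config.map f) := by
  induction os generalizing c with
  | nil => rfl
  | cons o os ih =>
    simp only [run, step_map]
    cases step m b c o with
    | none => rfl
    | some c' => simpa using ih c'

theorem initial_map {α β : Type} (f : α → β) (D : List (List α)) :
    initial (D.map (List.map f)) = (initial D).map f := by
  simp only [initial, Config.map, List.map_nil, Config.mk.injEq, true_and]
  funext i
  simp only [List.getD_eq_getElem?_getD, List.getElem?_map]
  cases D[i]? <;> simp

theorem output_map {α β : Type} (f : α → β) (P : Program) (c : Config α) :
    P.output (c.map f) = (P.output c).map f := by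
  simp [Program.output, Config.map, List.map_flatMap]

/-! ### Blocks that are used -/

/-- The block addresses of the I/O operations, in order. -/
def addrs : List Op → List ℕ
  | [] => []
  | .read i :: os => i :: addrs os
  | .write i _ :: os => i :: addrs os
  | .compute _ :: os => addrs os

theorem length_addrs (os : List Op) : (addrs os).length = ioCount os := by
  induction os with
  | nil => rfl
  | cons o os ih => cases o <;> simp [addrs, ioCount, ih]

theorem run_cons {α : Type} {m b : ℕ} {o : Op} {os : List Op} {c c' : Config α}
    (h : run m b (o :: os) c = some c') :
    ∃ d, step m b c o = some d ∧ run m b os d = some c' :=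
  Option.bind_eq_some_iff.1 h

theorem step_read {α : Type} {m b i : ℕ} {c d : Config α} (h : step m b c (.read i) = some d) :
    (c.ram ++ c.disk i).length ≤ m ∧ d = ⟨c.ram ++ c.disk i, c.disk⟩ := by
  simp only [step] at h
  split_ifs at h with h'
  exact ⟨h', (Option.some.inj h).symm⟩

theorem step_write {α : Type} {m b i : ℕ} {s : List ℕ} {c d : Config α}
    (h : step m b c (.write i s) = some d) :
    (select c.ram s).length ≤ b ∧ d = ⟨c.ram, Function.update c.disk i (select c.ram s)⟩ := by
  simp only [step] at h
  split_ifs at h with h'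
  exact ⟨h', (Option.some.inj h).symm⟩

theorem step_compute {α : Type} {m b : ℕ} {s : List ℕ} {c d : Config α}
    (h : step m b c (.compute s) = some d) :
    (select c.ram s).length ≤ m ∧ d = ⟨select c.ram s, c.disk⟩ := by
  simp only [step] at h
  split_ifs at h with h'
  exact ⟨h', (Option.some.inj h).symm⟩

theorem run_disk_of_notMem {α : Type} {m b : ℕ} {os : List Op} {c c' : Config α}
    (h : run m b os c = some c') {i : ℕ} (hi : i ∉ addrs os) : c'.disk i = c.disk i := by
  induction os generalizing c with
  | nil => cases h; rfl
  | cons o os ih =>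
    obtain ⟨d, hd, hr⟩ := run_cons h
    cases o with
    | read j =>
      obtain ⟨-, rfl⟩ := step_read hd
      have := ih hr (by simp_all [addrs])
      exact this
    | write j s =>
      obtain ⟨-, rfl⟩ := step_write hd
      simp only [addrs, List.mem_cons, not_or] at hi
      rw [ih hr hi.2]
      exact Function.update_of_ne hi.1 _ _
    | compute s =>
      obtain ⟨-, rfl⟩ := step_compute hd
      have := ih hr hi
      exact this

theorem run_disk_length_le {α : Type} {m b : ℕ} {os : List Op} {c c' : Config α}
    (h : run m b os c = some c') (hc : ∀ i, (c.disk i).length ≤ b) (i : ℕ) :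
    (c'.disk i).length ≤ b := by
  induction os generalizing c with
  | nil => cases h; exact hc i
  | cons o os ih =>
    obtain ⟨d, hd, hr⟩ := run_cons h
    cases o with
    | read j =>
      obtain ⟨-, rfl⟩ := step_read hd
      exact ih hr hc
    | write j s =>
      obtain ⟨hl, rfl⟩ := step_write hd
      refine ih hr fun k => ?_
      by_cases hk : k = j
      · subst hk; simpa using hl
      · simpa [Function.update_of_ne hk] using hc k
    | compute s =>
      obtain ⟨-, rfl⟩ := step_compute hd
      exact ih hr hc

/-! ### Tracking the labels with a given property -/

/-- The set of labels in a list that satisfy `p`. -/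
def labels (p : ℕ → Prop) [DecidablePred p] (L : List ℕ) : Finset ℕ :=
  L.toFinset.filter p

theorem mem_labels {p : ℕ → Prop} [DecidablePred p] {L : List ℕ} {x : ℕ} :
    x ∈ labels p L ↔ x ∈ L ∧ p x := by
  simp [labels]

theorem labels_append (p : ℕ → Prop) [DecidablePred p] (L L' : List ℕ) :
    labels p (L ++ L') = labels p L ∪ labels p L' := by
  ext x; simp only [mem_labels, Finset.mem_union, List.mem_append]; tauto

theorem labels_select_subset (p : ℕ → Prop) [DecidablePred p] (r : List ℕ) (s : List ℕ) :
    labels p (select r s) ⊆ labels p r := fun x hx => by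
  rw [mem_labels] at hx ⊢
  exact ⟨mem_of_mem_select hx.1, hx.2⟩

theorem sum_card_labels_le {l : ℕ} (L : List ℕ) :
    ∑ r ∈ Finset.range l, (labels (fun x => x % l = r) L).card ≤ L.length := by
  refine le_trans ?_ (List.toFinset_card_le L)
  rw [← Finset.card_biUnion]
  · refine Finset.card_le_card fun x hx => ?_
    simp only [Finset.mem_biUnion, mem_labels] at hx
    obtain ⟨_, _, h, _⟩ := hx
    exact List.mem_toFinset.2 h
  · intro r _ s _ hrs
    refine Finset.disjoint_left.2 fun x hx hx' => hrs ?_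
    rw [mem_labels] at hx hx'
    exact hx.2.symm.trans hx'.2

/-- Total number of tracked labels in RAM, counted twice after every I/O. -/
def ramCost (p : ℕ → Prop) [DecidablePred p] (m b : ℕ) : List Op → Config ℕ → ℕ
  | [], _ => 0
  | .read i :: os, c => match step m b c (.read i) with
    | none => 0
    | some d => 2 * (labels p d.ram).card + ramCost p m b os d
  | .write i s :: os, c => match step m b c (.write i s) with
    | none => 0
    | some d => 2 * (labels p d.ram).card + ramCost p m b os d
  | .compute s :: os, c => match step m b c (.compute s) with
    | none => 0
    | some d => ramCost p m b os d

/-- Total number of tracked labels in the blocks that are transferred. -/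
def ioCost (p : ℕ → Prop) [DecidablePred p] (m b : ℕ) : List Op → Config ℕ → ℕ
  | [], _ => 0
  | .read i :: os, c => match step m b c (.read i) with
    | none => 0
    | some d => (labels p (d.disk i)).card + ioCost p m b os d
  | .write i s :: os, c => match step m b c (.write i s) with
    | none => 0
    | some d => (labels p (d.disk i)).card + ioCost p m b os d
  | .compute s :: os, c => match step m b c (.compute s) with
    | none => 0
    | some d => ioCost p m b os d

/-- The residue classes are disjoint, so over all classes together an I/O is charged at most twice
the RAM capacity. -/
theorem sum_ramCost_le {l m b : ℕ} (os : List Op) (c : Config ℕ) (hc : c.ram.length ≤ m) :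
    ∑ r ∈ Finset.range l, ramCost (fun x => x % l = r) m b os c ≤ ioCount os * (2 * m) := by
  induction os generalizing c with
  | nil => simp [ramCost]
  | cons o os ih =>
    cases hd : step m b c o with
    | none => cases o <;> simp [ramCost, hd]
    | some d =>
      cases o with
      | read i =>
        obtain ⟨hl, hd'⟩ := step_read hd
        have hm : d.ram.length ≤ m := by rw [hd']; exact hl
        simp only [ramCost, hd, Finset.sum_add_distrib, ← Finset.mul_sum, ioCount, add_mul, one_mul]
        have := ih d hm
        have := sum_card_labels_le (l := l) d.ram
        omega
      | write i s =>
        obtain ⟨-, hd'⟩ := step_write hd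
        have hm : d.ram.length ≤ m := by rw [hd']; exact hc
        simp only [ramCost, hd, Finset.sum_add_distrib, ← Finset.mul_sum, ioCount, add_mul, one_mul]
        have := ih d hm
        have := sum_card_labels_le (l := l) d.ram
        omega
      | compute s =>
        obtain ⟨hl, hd'⟩ := step_compute hd
        have hm : d.ram.length ≤ m := by rw [hd']; exact hl
        simpa only [ramCost, hd, ioCount] using ih d hm

theorem sum_ioCost_le {l m b : ℕ} (os : List Op) (c : Config ℕ)
    (hc : ∀ i, (c.disk i).length ≤ b) :
    ∑ r ∈ Finset.range l, ioCost (fun x => x % l = r) m b os c ≤ ioCount os * b := by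
  induction os generalizing c with
  | nil => simp [ioCost]
  | cons o os ih =>
    cases hd : step m b c o with
    | none => cases o <;> simp [ioCost, hd]
    | some d =>
      have hm : ∀ i, (d.disk i).length ≤ b :=
        run_disk_length_le (m := m) (os := [o]) (by simp [run, hd]) hc
      cases o with
      | compute s => simpa only [ioCost, hd, ioCount] using ih d hm
      | _ i =>
        simp only [ioCost, hd, Finset.sum_add_distrib, ioCount, add_mul, one_mul]
        have := ih d hm
        have := sum_card_labels_le (l := l) (d.disk i)
        have := hm i
        omega

/-! ### Encoding the movement of the tracked labels by a bit string -/

/-- The subset of `A` that is marked by the leading bits. -/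
def marked (A : Finset ℕ) (bits : List Bool) : Finset ℕ :=
  A.filter fun x => (x, true) ∈ (A.sort (· ≤ ·)).zip bits

/-- The bits that mark the subset `D` of `A`. -/
def marks (A D : Finset ℕ) : List Bool :=
  (A.sort (· ≤ ·)).map fun x => decide (x ∈ D)

theorem length_marks (A D : Finset ℕ) : (marks A D).length = A.card := by
  simp [marks]

theorem count_marks {A D : Finset ℕ} (h : D ⊆ A) : (marks A D).count true = D.card := by
  rw [marks, List.count_eq_countP, List.countP_map, List.countP_eq_length_filter,
    ← List.toFinset_card_of_nodup ((Finset.sort_nodup A _).filter _)]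
  congr 1
  ext x
  simp only [List.mem_toFinset, List.mem_filter, Finset.mem_sort, Function.comp]
  simp only [beq_true, decide_eq_true_eq]
  exact ⟨fun h => h.2, fun hx => ⟨h hx, hx⟩⟩

theorem marked_marks {A D : Finset ℕ} (h : D ⊆ A) (e : List Bool) :
    marked A (marks A D ++ e) = D := by
  have : (A.sort (· ≤ ·)).zip (marks A D ++ e)
      = (A.sort (· ≤ ·)).map fun x => (x, decide (x ∈ D)) := by
    rw [marks]
    generalize A.sort (· ≤ ·) = L
    induction L with
    | nil => simp
    | cons x L ih => simp [ih]
  ext x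
  simp only [marked, this, Finset.mem_filter, List.mem_map, Finset.mem_sort, Prod.mk.injEq]
  constructor
  · rintro ⟨-, y, -, rfl, hy⟩
    simpa using hy
  · intro hx
    exact ⟨h hx, x, h hx, rfl, by simpa using hx⟩

/-- Replay of the I/Os on sets of labels. Before each I/O, the bits tell which labels have been
discarded from the RAM, and for a write also which labels are written. -/
def replay : List (Bool × ℕ) → List Bool → Finset ℕ → (ℕ → Finset ℕ) → ℕ → Finset ℕ
  | [], _, _, d => d
  | (false, i) :: is, bits, A, d =>
      replay is (bits.drop A.card) ((A \ marked A bits) ∪ d i) d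
  | (true, i) :: is, bits, A, d =>
      replay is ((bits.drop A.card).drop (A \ marked A bits).card) (A \ marked A bits)
        (Function.update d i (marked (A \ marked A bits) (bits.drop A.card)))

/-- The kinds (`true` for write) and the renamed addresses of the I/Os. -/
def skeleton (ρ : ℕ → ℕ) : List Op → List (Bool × ℕ)
  | [] => []
  | .read i :: os => (false, ρ i) :: skeleton ρ os
  | .write i _ :: os => (true, ρ i) :: skeleton ρ os
  | .compute _ :: os => skeleton ρ os

theorem length_skeleton (ρ : ℕ → ℕ) (os : List Op) : (skeleton ρ os).length = ioCount os := by
  induction os with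
  | nil => rfl
  | cons o os ih => cases o <;> simp [skeleton, ioCount, ih]

theorem exists_mem_addrs_of_mem_skeleton {ρ : ℕ → ℕ} {os : List Op} {q : Bool × ℕ}
    (h : q ∈ skeleton ρ os) : ∃ i ∈ addrs os, q.2 = ρ i := by
  induction os with
  | nil => simp [skeleton] at h
  | cons o os ih =>
    cases o with
    | compute s => exact ih h
    | _ i =>
      simp only [skeleton, List.mem_cons] at h
      rcases h with rfl | h
      · exact ⟨i, by simp [addrs], rfl⟩
      · obtain ⟨j, hj, hq⟩ := ih h
        exact ⟨j, by simp [addrs, hj], hq⟩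

/-- The labels in RAM after an I/O may need marking twice: for the selection made by a write and for
the discards before the next I/O; hence the factor 2 in `ramCost`. For the number of ones, `A.card`
acts as a potential: a label can be discarded only after it was read, so discards are paid for by
the blocks read, and the marks of a write by the block written. Surplus bits `e` are harmless, so
that all bit strings can be padded to one length. The renaming `ρ` serves to make addresses small.
-/
theorem exists_bits_replay (p : ℕ → Prop) [DecidablePred p] {m b : ℕ} {ρ : ℕ → ℕ} {S : Set ℕ}
    (hρ : Set.InjOn ρ S) (os : List Op) (c c' : Config ℕ) (h : run m b os c = some c')
    (hS : ∀ i ∈ addrs os, i ∈ S) (A : Finset ℕ) (d : ℕ → Finset ℕ)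
    (hA : labels p c.ram ⊆ A) (hd : ∀ i ∈ S, d (ρ i) = labels p (c.disk i)) :
    ∃ bits : List Bool, bits.length ≤ A.card + ramCost p m b os c ∧
      bits.count true ≤ A.card + ioCost p m b os c ∧
      ∀ e, ∀ i ∈ S, replay (skeleton ρ os) (bits ++ e) A d (ρ i) = labels p (c'.disk i) := by
  induction os generalizing c A d with
  | nil =>
    cases h
    exact ⟨[], by simp, by simp, fun e i hi => by simpa [skeleton, replay] using hd i hi⟩
  | cons o os ih =>
    obtain ⟨c₁, hc₁, hr⟩ := run_cons h
    -- `A` contains the tracked labels left in RAM by the previous I/O. Computation in between only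
    -- shrinks the RAM and costs no bits; the loss `A \ labels p c.ram` is recorded at the next I/O.
    have hdis : A \ (A \ labels p c.ram) = labels p c.ram := Finset.sdiff_sdiff_eq_self hA
    have hcard : (A \ labels p c.ram).card + (labels p c.ram).card = A.card :=
      Finset.card_sdiff_add_card_eq_card hA
    cases o with
    | read i =>
      have hi : i ∈ S := hS i (by simp [addrs])
      obtain ⟨-, hc₁'⟩ := step_read hc₁
      have hram : labels p c₁.ram = labels p c.ram ∪ labels p (c.disk i) := by
        rw [hc₁', labels_append]
      have hdisk : c₁.disk = c.disk := by rw [hc₁']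
      obtain ⟨bits, h1, h2, h3⟩ := ih c₁ hr (fun j hj => hS j (by simp [addrs, hj]))
        (labels p c₁.ram) d subset_rfl (by rw [hdisk]; exact hd)
      have hle : (labels p c₁.ram).card ≤ (labels p c.ram).card + (labels p (c.disk i)).card := by
        rw [hram]; exact Finset.card_union_le _ _
      refine ⟨marks A (A \ labels p c.ram) ++ bits, ?_, ?_, fun e j hj => ?_⟩
      · simp only [List.length_append, length_marks, ramCost, hc₁]
        omega
      · rw [List.count_append, count_marks Finset.sdiff_subset]
        simp only [ioCost, hc₁, hdisk]
        omega
      · rw [List.append_assoc]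
        simp only [skeleton, replay, marked_marks Finset.sdiff_subset, hdis]
        rw [← length_marks A (A \ labels p c.ram), List.drop_left, hd i hi, ← hram]
        exact h3 e j hj
    | write i s =>
      have hi : i ∈ S := hS i (by simp [addrs])
      obtain ⟨-, hc₁'⟩ := step_write hc₁
      have hram : c₁.ram = c.ram := by rw [hc₁']
      have hdisk : c₁.disk = Function.update c.disk i (select c.ram s) := by rw [hc₁']
      have hsub := labels_select_subset p c.ram s
      obtain ⟨bits, h1, h2, h3⟩ := ih c₁ hr (fun j hj => hS j (by simp [addrs, hj]))
        (labels p c.ram) (Function.update d (ρ i) (labels p (select c.ram s)))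
        (by rw [hram]) (fun j hj => by
          rw [hdisk]
          by_cases hji : j = i
          · subst hji; simp
          · rw [Function.update_of_ne hji, Function.update_of_ne fun h => hji (hρ hj hi h)]
            exact hd j hj)
      refine ⟨marks A (A \ labels p c.ram) ++
        (marks (labels p c.ram) (labels p (select c.ram s)) ++ bits), ?_, ?_, fun e j hj => ?_⟩
      · simp only [List.length_append, length_marks, ramCost, hc₁, hram]
        omega
      · rw [List.count_append, List.count_append, count_marks Finset.sdiff_subset,
          count_marks hsub]
        simp only [ioCost, hc₁, hdisk, Function.update_self]
        omega
      · rw [List.append_assoc, List.append_assoc]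
        simp only [skeleton, replay, marked_marks Finset.sdiff_subset, hdis]
        rw [← length_marks A (A \ labels p c.ram), List.drop_left, marked_marks hsub,
          ← length_marks (labels p c.ram) (labels p (select c.ram s)), List.drop_left]
        exact h3 e j hj
    | compute s =>
      obtain ⟨-, hc₁'⟩ := step_compute hc₁
      have hdisk : c₁.disk = c.disk := by rw [hc₁']
      obtain ⟨bits, h1, h2, h3⟩ := ih c₁ hr (fun j hj => hS j hj) A d
        (by rw [hc₁']; exact (labels_select_subset p c.ram s).trans hA) (by rw [hdisk]; exact hd)
      exact ⟨bits, by simpa only [ramCost, hc₁] using h1, by simpa only [ioCost, hc₁] using h2, h3⟩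

/-! ### Factorizations that permute chunks -/

theorem literals_append {α : Type} (F G : List (Phrase α)) :
    literals (F ++ G) = literals F ++ literals G := by
  induction F with
  | nil => rfl
  | cons x F ih => cases x <;> simp [literals, ih]

theorem numRep_append {α : Type} (F G : List (Phrase α)) :
    numRep (F ++ G) = numRep F + numRep G := by
  induction F with
  | nil => simp [numRep]
  | cons x F ih => cases x <;> simp [numRep, ih]; omega

theorem literals_map_literal {α β : Type} (u : β → α) (L : List β) :
    literals (L.map fun t => Phrase.literal (u t)) = L.map u := by
  induction L with
  | nil => rfl
  | cons x L ih => simp [literals, ih]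

theorem numRep_map_literal {α β : Type} (u : β → α) (L : List β) :
    numRep (L.map fun t => Phrase.literal (u t)) = 0 := by
  induction L with
  | nil => rfl
  | cons x L ih => simp [numRep, ih]

theorem literals_map_rep {α β : Type} (u : β → ℕ) (l : ℕ) (L : List β) :
    literals (L.map fun t => (Phrase.rep (u t) l : Phrase α)) = [] := by
  induction L with
  | nil => rfl
  | cons x L ih => simp [literals, ih]

theorem numRep_map_rep {α β : Type} (u : β → ℕ) (l : ℕ) (L : List β) :
    numRep (L.map fun t => (Phrase.rep (u t) l : Phrase α)) = L.length := by
  induction L with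
  | nil => rfl
  | cons x L ih => simp [numRep, ih]

theorem parsesFrom_map_literal {α : Type} {X : List α} {u : ℕ → α} {F : List (Phrase α)}
    (k i : ℕ) (h : ∀ t < k, X[i + t]? = some (u t)) (hF : ParsesFrom X (i + k) F) :
    ParsesFrom X i (((List.range k).map fun t => Phrase.literal (u t)) ++ F) := by
  induction k generalizing F with
  | zero => simpa using hF
  | succ k ih =>
    rw [List.range_succ, List.map_append, List.append_assoc]
    exact ih (fun t ht => h t (by omega)) ⟨h k (by omega), hF⟩

theorem parsesFrom_map_rep {α : Type} {X : List α} {u : ℕ → ℕ} {l : ℕ} {F : List (Phrase α)}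
    (hl : 1 ≤ l) (k i : ℕ) (hX : i + k * l ≤ X.length) (hu : ∀ t < k, u t < i)
    (h : ∀ t < k, ∀ s < l, X[u t + s]? = X[i + t * l + s]?) (hF : ParsesFrom X (i + k * l) F) :
    ParsesFrom X i (((List.range k).map fun t => Phrase.rep (u t) l) ++ F) := by
  induction k generalizing F with
  | zero => simpa using hF
  | succ k ih =>
    rw [add_one_mul] at hX hF
    rw [List.range_succ, List.map_append, List.append_assoc]
    refine ih (by omega) (fun t ht => hu t (by omega)) (fun t ht => h t (by omega)) ?_
    refine ⟨⟨(hu k (by omega)).trans_le (by omega), hl, by omega, h k (by omega)⟩, ?_⟩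
    rwa [add_assoc]

/-- The literal that the symbol at a position of the string stems from: `K` chunks of length `l`
are followed by the same chunks in the order `π`, and by further literals. -/
def source (l K : ℕ) (π : ℕ → ℕ) (x : ℕ) : ℕ :=
  if x < K * l then x
  else if x < K * l + K * l then π ((x - K * l) / l) * l + (x - K * l) % l
  else x - K * l

/-- Chunks and filler are displaced by multiples of `l` only. Hence a stretch of output contains few
labels of any one residue class, whatever `π` is. -/
theorem source_mod (l K : ℕ) (π : ℕ → ℕ) (x : ℕ) : source l K π x % l = x % l := by
  unfold source
  split_ifs with h1 h2
  · rfl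
  · rw [Nat.mul_add_mod_self_right, Nat.mod_mod]
    conv_rhs => rw [← Nat.sub_add_cancel (not_lt.1 h1), Nat.add_mul_mod_self_right]
  · conv_rhs => rw [← Nat.sub_add_cancel (not_lt.1 h1), Nat.add_mul_mod_self_right]

theorem source_chunk {l K : ℕ} (π : ℕ → ℕ) {j r : ℕ} (hj : j < K) (hr : r < l) :
    source l K π (K * l + j * l + r) = π j * l + r := by
  have h : j * l + r < K * l := by
    calc j * l + r < j * l + l := by omega
      _ = (j + 1) * l := by ring
      _ ≤ K * l := Nat.mul_le_mul_right _ hj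
  have hl : 0 < l := by omega
  rw [source, if_neg (by omega), if_pos (by omega),
    show K * l + j * l + r - K * l = r + j * l by omega, Nat.add_mul_div_right _ _ hl,
    Nat.add_mul_mod_self_right, Nat.div_eq_of_lt hr, Nat.mod_eq_of_lt hr, zero_add]

/-- The string of length `n` with literals `w`. -/
def chunkString {α : Type} (n l K : ℕ) (π : ℕ → ℕ) (w : ℕ → α) : List α :=
  (List.range n).map fun x => w (source l K π x)

/-- The factorization of `chunkString`. -/
def chunkFactorization {α : Type} (n l K : ℕ) (π : ℕ → ℕ) (w : ℕ → α) : List (Phrase α) :=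
  ((List.range (K * l)).map fun t => Phrase.literal (w t)) ++
    (((List.range K).map fun j => Phrase.rep (π j * l) l) ++
      (((List.range (n - (K * l + K * l))).map fun t => Phrase.literal (w (K * l + t))) ++ []))

theorem map_shape_chunkFactorization {α : Type} (n l K : ℕ) (π : ℕ → ℕ) (w w' : ℕ → α) :
    (chunkFactorization n l K π w).map Phrase.shape
      = (chunkFactorization n l K π w').map Phrase.shape := by
  simp [chunkFactorization, Phrase.shape, Function.comp_def]

theorem literals_chunkFactorization {α : Type} {n l K : ℕ} (h : K * l + K * l ≤ n) (π : ℕ → ℕ)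
    (w : ℕ → α) :
    literals (chunkFactorization n l K π w) = (List.range (n - K * l)).map w := by
  rw [chunkFactorization, literals_append, literals_append, literals_append, literals_map_literal,
    literals_map_rep, literals_map_literal,
    show n - K * l = K * l + (n - (K * l + K * l)) by omega, List.range_add]
  simp [literals, Function.comp_def]

theorem numRep_chunkFactorization {α : Type} (n l K : ℕ) (π : ℕ → ℕ) (w : ℕ → α) :
    numRep (chunkFactorization n l K π w) = K := by
  simp [chunkFactorization, numRep_append, numRep_map_literal, numRep_map_rep]

theorem chunkString_getElem? {α : Type} {n : ℕ} (l K : ℕ) (π : ℕ → ℕ) (w : ℕ → α) {x : ℕ}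
    (hx : x < n) : (chunkString n l K π w)[x]? = some (w (source l K π x)) := by
  simp [chunkString, hx]

theorem isFactorization_chunk {α : Type} {n l K : ℕ} (hl : 1 ≤ l) (h : K * l + K * l ≤ n)
    {π : ℕ → ℕ} (hπ : ∀ j < K, π j < K) (w : ℕ → α) :
    IsFactorization (chunkFactorization n l K π w) (chunkString n l K π w) := by
  have hlen : (chunkString n l K π w).length = n := by simp [chunkString]
  have hlt : ∀ j < K, ∀ s < l, j * l + s < K * l := fun j hj s hs => by
    calc j * l + s < j * l + l := by omega
      _ = (j + 1) * l := by ring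
      _ ≤ K * l := Nat.mul_le_mul_right _ hj
  refine parsesFrom_map_literal _ _ (fun t ht => ?_) (parsesFrom_map_rep hl _ _ ?_ (fun j hj => ?_)
    (fun j hj s hs => ?_) (parsesFrom_map_literal _ _ (fun t ht => ?_) ?_))
  · rw [zero_add, chunkString_getElem? _ _ _ _ (by omega), source, if_pos ht]
  · rw [hlen]; omega
  · have := hlt _ (hπ j hj) 0 (by omega); omega
  · have h1 := hlt _ (hπ j hj) s hs
    have h2 := hlt _ hj s hs
    rw [chunkString_getElem? _ _ _ _ (by omega), chunkString_getElem? _ _ _ _ (by omega), zero_add,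
      source_chunk π hj hs, source, if_pos h1]
  · rw [chunkString_getElem? _ _ _ _ (by omega), source, if_neg (by omega), if_neg (by omega)]
    congr 2; omega
  · simp only [ParsesFrom, hlen]; omega

/-! ### Layouts of consecutive labels -/

/-- Literals are stored in order, so each input block is an interval of labels; two endpoints
describe it in a code. -/
theorem exists_split_range' (L : List ℕ) (s : ℕ) :
    ∃ D : List (List ℕ), D.map List.length = L ∧ D.flatten = List.range' s L.sum ∧
      ∀ i, ∃ u v, u ≤ s + L.sum ∧ v ≤ s + L.sum ∧ ∀ x, x ∈ D.getD i [] ↔ u ≤ x ∧ x < v := by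
  induction L generalizing s with
  | nil => exact ⟨[], rfl, rfl, fun i => ⟨0, 0, by simp, by simp, by simp⟩⟩
  | cons k L ih =>
    obtain ⟨D, h1, h2, h3⟩ := ih (s + k)
    refine ⟨List.range' s k :: D, by simp [h1], ?_, fun i => ?_⟩
    · simp [h2, List.range'_append_1]
    · cases i with
      | zero => exact ⟨s, s + k, by simp, by simp, fun x => by simp⟩
      | succ i =>
        obtain ⟨u, v, hu, hv, h⟩ := h3 i
        exact ⟨u, v, by simp; omega, by simp; omega, fun x => by simpa using h x⟩

/-- A decoder that recovers the string for all symbols over an alphabet with two letters moves the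
label of the right literal to every output position. -/
theorem exists_run_labels {α : Type} {a₀ a₁ : α} (ha : a₀ ≠ a₁) {n l K m b : ℕ} (hl : 1 ≤ l)
    (h : K * l + K * l ≤ n) {π : ℕ → ℕ} (hπ : ∀ j < K, π j < K) (w₀ : ℕ → α) {P : Program}
    {L : List ℕ} (hP : Decodes m b P (chunkFactorization n l K π w₀) L)
    {D : List (List ℕ)} (hD : D.map List.length = L) (hDf : D.flatten = List.range (n - K * l)) :
    ∃ c, run m b P.ops (initial D) = some c ∧ P.output c = (List.range n).map (source l K π) := by
  classical
  have key : ∀ w : ℕ → α, ∃ c, run m b P.ops (initial D) = some c ∧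
      (P.output c).map w = chunkString n l K π w := fun w => by
    obtain ⟨c, hc, hout⟩ := hP.2 _ _ (map_shape_chunkFactorization n l K π w w₀)
      (isFactorization_chunk hl h hπ w) (D.map (List.map w))
      (by rw [← hD, List.map_map]; exact List.map_congr_left fun x _ => by simp)
      (by rw [← List.map_flatten, hDf, literals_chunkFactorization h])
    rw [initial_map, run_map] at hc
    obtain ⟨c', hc', rfl⟩ := Option.map_eq_some_iff.1 hc
    exact ⟨c', hc', by rw [← output_map, hout]⟩
  obtain ⟨c, hc, h0⟩ := key w₀
  refine ⟨c, hc, ?_⟩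
  have hlen : (P.output c).length = n := by
    have := congrArg List.length h0
    simpa [chunkString] using this
  refine List.ext_getElem (by simp [hlen]) fun x hx hx' => ?_
  -- Two letters cannot separate all labels at once, so the word is chosen per position: the
  -- indicator of the expected label. The label run is the same for every word, so the label found
  -- at `x` must be that one.
  obtain ⟨c', hc', h1⟩ := key fun y => if y = source l K π x then a₁ else a₀
  obtain rfl : c = c' := Option.some.inj (hc.symm.trans hc')
  have h2 := congrArg (fun L => L[x]?) h1
  rw [chunkString_getElem? _ _ _ _ (by omega), List.getElem?_map, List.getElem?_eq_getElem hx,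
    Option.map_some, if_pos rfl] at h2
  by_contra hne
  rw [if_neg (by simpa using hne)] at h2
  exact ha (Option.some.inj h2)

/-! ### Positions in the output -/

theorem exists_block_of_lt (f : ℕ → List ℕ) (N x : ℕ) (hx : x < ((List.range N).flatMap f).length) :
    ∃ j < N, ((List.range j).flatMap f).length ≤ x ∧
      x < ((List.range j).flatMap f).length + (f j).length := by
  induction N with
  | zero => simp at hx
  | succ N ih =>
    by_cases hN : x < ((List.range N).flatMap f).length
    · obtain ⟨j, hj, h⟩ := ih hN
      exact ⟨j, by omega, h⟩
    · rw [List.range_succ, List.flatMap_append, List.length_append] at hx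
      exact ⟨N, by omega, by omega, by simpa using hx⟩

theorem length_flatMap_range_mono (f : ℕ → List ℕ) {i j : ℕ} (hij : i < j) :
    ((List.range i).flatMap f).length + (f i).length ≤ ((List.range j).flatMap f).length := by
  induction j with
  | zero => omega
  | succ j ih =>
    rw [List.range_succ, List.flatMap_append, List.length_append]
    rcases Nat.lt_succ_iff_lt_or_eq.1 hij with h | rfl
    · have := ih h; omega
    · simp

theorem getElem?_block (f : ℕ → List ℕ) {N j t : ℕ} (hj : j < N) (ht : t < (f j).length) :
    ((List.range N).flatMap f)[((List.range j).flatMap f).length + t]? = (f j)[t]? := by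
  obtain ⟨k, rfl⟩ := Nat.exists_eq_add_of_lt hj
  rw [add_assoc, List.range_add, List.flatMap_append, List.getElem?_append_right (by omega),
    Nat.add_sub_cancel_left, List.range_succ_eq_map, List.map_cons, List.flatMap_cons,
    List.getElem?_append_left (by simpa using ht)]
  rfl

/-! ### Counting the permutations that can be decoded -/

theorem card_filter_mod_le {l : ℕ} (hl : 1 ≤ l) (s e r : ℕ) :
    ((Finset.Ico s e).filter fun y => y % l = r).card ≤ (e - s) / l + 1 := by
  rw [← Finset.card_range ((e - s) / l + 1)]
  refine Finset.card_le_card_of_injOn (fun y => (y - s) / l) (fun y hy => ?_) ?_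
  · simp only [Finset.coe_filter, Finset.mem_Ico, Set.mem_ofPred_eq] at hy
    simp only [Finset.coe_range, Set.mem_Iio]
    exact Nat.lt_succ_of_le (Nat.div_le_div_right (by omega))
  · have key : ∀ y y' : ℕ, s ≤ y → y < y' → y % l = y' % l → (y - s) / l < (y' - s) / l :=
      fun y y' h1 h2 h3 => by
        have h4 : l ∣ y' - y := (Nat.modEq_iff_dvd' h2.le).1 h3
        have h5 : l ≤ y' - y := Nat.le_of_dvd (by omega) h4
        calc (y - s) / l < (y - s + l) / l := by rw [Nat.add_div_right _ (by omega)]; omega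
          _ ≤ (y' - s) / l := Nat.div_le_div_right (by omega)
    intro y hy y' hy' hyy
    simp only [Finset.coe_filter, Finset.mem_Ico, Set.mem_ofPred_eq] at hy hy' hyy
    rcases lt_trichotomy y y' with h | h | h
    · exact absurd hyy (key y y' hy.1.1 h (by omega)).ne
    · exact h
    · exact absurd hyy (key y' y hy'.1.1 h (by omega)).ne'

/-- Padding with zeros turns bit strings of varying length into subsets of one fixed set without
adding ones. -/
theorem exists_finset_bits {R : ℕ} (bits : List Bool) (h : bits.length ≤ R) :
    ∃ s : Finset (Fin R), s.card = bits.count true ∧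
      List.ofFn (fun i => decide (i ∈ s)) = bits ++ List.replicate (R - bits.length) false := by
  set L := bits ++ List.replicate (R - bits.length) false with hL
  have hlen : L.length = R := by simp [hL]; omega
  let s : Finset (Fin R) := Finset.univ.filter fun i => L[i.1]'(by omega) = true
  have hs : List.ofFn (fun i => decide (i ∈ s)) = L := by
    refine List.ext_getElem (by simp [hlen]) fun i h1 h2 => ?_
    simp [s]
  refine ⟨s, ?_, hs⟩
  have h1 : L.count true = bits.count true := by
    rw [hL, List.count_append, List.count_replicate]; simp
  rw [← h1, ← hs, List.ofFn_eq_map, List.count_eq_countP, List.countP_map,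
    List.countP_eq_length_filter,
    ← List.toFinset_card_of_nodup ((List.nodup_finRange R).filter _)]
  congr 1
  ext x
  simp

/-- Both bounds are twice the respective averages. Weighting `u` by `b` and `v` by `2 * m` makes the
two budgets equal; a class violating either bound would exceed the average of the weighted sum. -/
theorem exists_residue_le {l m b T : ℕ} (hm : 0 < m) (hb : 0 < b) (hl : 1 ≤ l) (u v : ℕ → ℕ)
    (hu : ∑ r ∈ Finset.range l, u r ≤ T * (2 * m)) (hv : ∑ r ∈ Finset.range l, v r ≤ T * b) :
    ∃ r < l, u r ≤ 4 * m * T / l ∧ v r ≤ 2 * b * T / l := by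
  by_contra! hcon
  have h : ∀ r ∈ Finset.range l, 4 * m * T * b < l * (b * u r + 2 * m * v r) := fun r hr => by
    have hr' := hcon r (Finset.mem_range.1 hr)
    by_cases h1 : u r ≤ 4 * m * T / l
    · have h2 := hr' h1
      rw [Nat.div_lt_iff_lt_mul (by omega)] at h2
      have := Nat.mul_lt_mul_of_pos_left h2 (show 0 < 2 * m by omega)
      nlinarith [Nat.zero_le (l * (b * u r))]
    · rw [not_le, Nat.div_lt_iff_lt_mul (by omega)] at h1
      have := Nat.mul_lt_mul_of_pos_left h1 hb
      nlinarith [Nat.zero_le (l * (m * v r))]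
  have h1 := Finset.sum_lt_sum_of_nonempty (Finset.nonempty_range_iff.2 (by omega)) h
  simp only [Finset.sum_const, Finset.card_range, smul_eq_mul, ← Finset.mul_sum,
    Finset.sum_add_distrib] at h1
  have h2 := Nat.lt_of_mul_lt_mul_left h1
  have h3 := Nat.mul_le_mul_left b hu
  have h4 := Nat.mul_le_mul_left (2 * m) hv
  nlinarith

/-- What determines the permutation up to the order inside the blocks: a residue class of labels,
the number of I/Os, their kinds and addresses, the contents of the blocks of the input, the place
of the blocks in the output, and the movement of the labels in the residue class. -/
abbrev Code (n l T R A : ℕ) : Type :=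
  Fin l × Fin (T + 1) × (Fin T → Bool × Fin T) × (Fin T → Fin (n + 1) × Fin (n + 1)) ×
    (Fin T → Fin (n + 1) × Fin (n + 1)) × {s : Finset (Fin R) // s.card ≤ A}

/-- The labels in the residue class that the blocks hold in the end. -/
def Code.final {n l T R A : ℕ} (q : Code n l T R A) : ℕ → Finset ℕ :=
  replay (((List.ofFn q.2.2.1).take q.2.1).map fun z => (z.1, z.2.1))
    (List.ofFn fun i : Fin R => decide (i ∈ q.2.2.2.2.2.1)) ∅
    fun a => if h : a < T then
      (Finset.Ico (q.2.2.2.1 ⟨a, h⟩).1.1 (q.2.2.2.1 ⟨a, h⟩).2.1).filter fun x => x % l = q.1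
    else ∅

/-- The chunks that can be the `j`-th repeated chunk. -/
def Code.candidates {n l T R A : ℕ} (K : ℕ) (q : Code n l T R A) (j : Fin K) : Finset (Fin K) :=
  Finset.univ.filter fun k => ∃ a : Fin T, (q.2.2.2.2.1 a).1.1 ≤ K * l + j * l + q.1 ∧
    K * l + j * l + q.1 < (q.2.2.2.2.1 a).2.1 ∧ k * l + q.1 ∈ q.final a

/-- A permutation is a choice function for the candidate sets of its code, and a code with small
sets has at most `g ^ K` of those. Codes with a larger set may exist; they are dropped, as no
permutation needs them. -/
theorem factorial_le_of_candidates {K g : ℕ} {ι : Type} [Fintype ι]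
    (S : ι → Fin K → Finset (Fin K))
    (h : ∀ π : Equiv.Perm (Fin K), ∃ c, ∀ j, π j ∈ S c j ∧ (S c j).card ≤ g) :
    K.factorial ≤ Fintype.card ι * g ^ K := by
  classical
  let U : Finset (Fin K → Fin K) := (Finset.univ.filter fun c => ∀ j, (S c j).card ≤ g).biUnion
    fun c => Fintype.piFinset (S c)
  have h1 : (Finset.univ : Finset (Equiv.Perm (Fin K))).card ≤ U.card := by
    refine Finset.card_le_card_of_injOn (fun π => ⇑π) (fun π _ => ?_)
      (fun π _ π' _ h => DFunLike.coe_injective h)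
    obtain ⟨c, hc⟩ := h π
    simp only [U, Finset.coe_biUnion, Set.mem_iUnion, Finset.mem_coe, Fintype.mem_piFinset]
    exact ⟨c, by simpa using fun j => (hc j).2, fun j => (hc j).1⟩
  rw [Finset.card_univ, Fintype.card_perm, Fintype.card_fin] at h1
  refine h1.trans (Finset.card_biUnion_le.trans ?_)
  refine (Finset.sum_le_card_nsmul _ _ (g ^ K) fun c hc => ?_).trans ?_
  · rw [Fintype.card_piFinset]
    simp only [Finset.mem_filter, Finset.mem_univ, true_and] at hc
    calc ∏ j, (S c j).card ≤ ∏ _j : Fin K, g := Finset.prod_le_prod' fun j _ => hc j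
      _ = g ^ K := by simp
  · rw [smul_eq_mul]
    exact Nat.mul_le_mul_right _ (Finset.card_le_univ _)

/-- A permutation as a function on numbers. -/
def natPerm {K : ℕ} (π : Equiv.Perm (Fin K)) (j : ℕ) : ℕ :=
  if h : j < K then π ⟨j, h⟩ else 0

theorem natPerm_lt {K : ℕ} (π : Equiv.Perm (Fin K)) : ∀ j < K, natPerm π j < K := fun j hj => by
  simp [natPerm, hj]

/-- The code is read off from the label run. It determines which tracked labels share the output
block with the tracked label of chunk `j`, so only their order inside the block remains open. -/
theorem exists_code {α : Type} {a₀ a₁ : α} (ha : a₀ ≠ a₁) {n l K m b T : ℕ} (hl : 1 ≤ l)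
    (hm : 0 < m) (hb : 0 < b) (h : K * l + K * l ≤ n) (π : Equiv.Perm (Fin K)) (w₀ : ℕ → α)
    {P : Program} {L : List ℕ} (hL : IsLayout b (chunkFactorization n l K (natPerm π) w₀) L)
    (hP : Decodes m b P (chunkFactorization n l K (natPerm π) w₀) L) (hT : ioCount P.ops ≤ T) :
    ∃ q : Code n l T (4 * m * T / l) (2 * b * T / l),
      ∀ j, π j ∈ q.candidates K j ∧ (q.candidates K j).card ≤ b / l + 1 := by
  classical
  have hsum : L.sum = n - K * l := by
    rw [hL.2, literals_chunkFactorization h]; simp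
  obtain ⟨D, hD, hDf, hDi⟩ := exists_split_range' L 0
  rw [hsum, ← List.range_eq_range'] at hDf
  simp only [zero_add, hsum] at hDi
  choose u v hu hv huv using hDi
  obtain ⟨c, hc, hout⟩ := exists_run_labels ha hl h (natPerm_lt π) w₀ hP hD hDf
  have hdisk₀ : ∀ i, ((initial D).disk i).length ≤ b := fun i => by
    simp only [initial, List.getD_eq_getElem?_getD]
    cases hi : D[i]? with
    | none => simp
    | some x =>
      refine hL.1 _ ?_
      rw [← hD]
      exact List.mem_map_of_mem (List.mem_of_getElem? hi)
  have hdisk : ∀ i, (c.disk i).length ≤ b := run_disk_length_le hc hdisk₀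
  obtain ⟨r, hrl, hr1, hr2⟩ := exists_residue_le (T := T) hm hb hl
    (fun r => ramCost (fun x => x % l = r) m b P.ops (initial D))
    (fun r => ioCost (fun x => x % l = r) m b P.ops (initial D))
    ((sum_ramCost_le _ _ (by simp [initial])).trans (Nat.mul_le_mul_right _ hT))
    ((sum_ioCost_le _ _ hdisk₀).trans (Nat.mul_le_mul_right _ hT))
  -- Addresses are unbounded, but at most `T` of them occur. They are replaced by their indices in
  -- this duplicate-free list.
  set U := (addrs P.ops).dedup with hU
  have hUn : U.Nodup := List.nodup_dedup _
  have hUT : U.length ≤ T :=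
    ((List.dedup_sublist _).length_le.trans (length_addrs _).le).trans hT
  have hmemU : ∀ {i}, i ∈ U ↔ i ∈ addrs P.ops := List.mem_dedup
  set ρ : ℕ → ℕ := fun i => U.idxOf i with hρ
  have hρlt : ∀ i ∈ U, ρ i < U.length := fun i hi => List.idxOf_lt_length_of_mem hi
  have hρU : ∀ i (hi : i ∈ U), U[ρ i]'(hρlt i hi) = i := fun i hi => List.getElem_idxOf _
  have hinj : Set.InjOn ρ {i | i ∈ U} := fun i hi j hj hij => by
    have h1 := List.getElem?_eq_getElem (hρlt i hi)
    have h2 := List.getElem?_eq_getElem (hρlt j hj)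
    rw [hρU i hi] at h1
    rw [hρU j hj, ← hij, h1] at h2
    exact Option.some.inj h2
  -- the code
  let start : ℕ → ℕ := fun j => ((List.range j).flatMap fun j => c.disk (P.outStart + j)).length
  have hstartn : ∀ j < P.outLen, start j + (c.disk (P.outStart + j)).length ≤ n := fun j hj => by
    refine (length_flatMap_range_mono (fun j => c.disk (P.outStart + j)) hj).trans ?_
    have := congrArg List.length hout
    simp only [Program.output, List.length_map, List.length_range] at this
    exact this.le
  let ins : Fin T → Bool × Fin T := fun t =>
    if ht : t < (skeleton ρ P.ops).length then
      ((skeleton ρ P.ops)[t.1].1, ⟨(skeleton ρ P.ops)[t.1].2, by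
        obtain ⟨i, hi, hq⟩ := exists_mem_addrs_of_mem_skeleton (List.getElem_mem ht)
        rw [hq]
        exact (hρlt i (hmemU.2 hi)).trans_le hUT⟩)
    else (false, t)
  have hins : ((List.ofFn ins).take (ioCount P.ops)).map (fun z => (z.1, z.2.1))
      = skeleton ρ P.ops := by
    refine List.ext_getElem (by simp [length_skeleton, hT]) fun i h1 h2 => ?_
    simp [ins, h2]
  let ini : Fin T → Fin (n + 1) × Fin (n + 1) := fun a =>
    if ha : a < U.length then (⟨u U[a.1], by have := hu U[a.1]; omega⟩,
      ⟨v U[a.1], by have := hv U[a.1]; omega⟩) else (0, 0)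
  -- The default `(0, 0)` is an empty interval, so indices that belong to no output block never
  -- match a position.
  let out : Fin T → Fin (n + 1) × Fin (n + 1) := fun a =>
    if ha : ∃ j < P.outLen, U[a.1]? = some (P.outStart + j) then
      (⟨start ha.choose, by have := hstartn _ ha.choose_spec.1; omega⟩,
        ⟨start ha.choose + (c.disk (P.outStart + ha.choose)).length, by
          have := hstartn _ ha.choose_spec.1; omega⟩)
    else (0, 0)
  obtain ⟨bits, hb1, hb2, hb3⟩ := exists_bits_replay (fun x => x % l = r) hinj P.ops (initial D) c
    hc (fun i hi => hmemU.2 hi) ∅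
    (fun a => if h : a < T then
      (Finset.Ico (ini ⟨a, h⟩).1.1 (ini ⟨a, h⟩).2.1).filter fun x => x % l = r else ∅)
    (by simp [initial, labels]) (fun i hi => by
      have h1 := hρlt i hi
      have h2 := hρU i hi
      simp only [h1.trans_le hUT, ini, h1, dite_true, h2]
      ext x
      rw [Finset.mem_filter, Finset.mem_Ico, mem_labels, ← huv]
      rfl)
  rw [Finset.card_empty, zero_add] at hb1 hb2
  obtain ⟨s, hs1, hs2⟩ := exists_finset_bits bits (hb1.trans hr1)
  let q : Code n l T (4 * m * T / l) (2 * b * T / l) :=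
    (⟨r, hrl⟩, ⟨ioCount P.ops, by omega⟩, ins, ini, out, ⟨s, by rw [hs1]; exact hb2.trans hr2⟩)
  have hfinal : ∀ i ∈ U, q.final (ρ i) = labels (fun x => x % l = r) (c.disk i) := fun i hi => by
    rw [← hb3 (List.replicate _ false) i hi, ← hs2]
    simp only [Code.final, q, hins]
  refine ⟨q, fun j => ?_⟩
  -- the block that holds the first tracked symbol of the chunk
  set x := K * l + j * l + r with hx
  have hxn : x < n := by
    have : j * l + r < K * l := by
      calc j * l + r < j * l + l := by omega
        _ = (j + 1) * l := by ring
        _ ≤ K * l := Nat.mul_le_mul_right _ j.2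
    omega
  obtain ⟨j₀, hj₀, hx1, hx2⟩ := exists_block_of_lt (fun j => c.disk (P.outStart + j)) P.outLen x
    (by
      have := congrArg List.length hout
      simp only [Program.output, List.length_map, List.length_range] at this
      rw [this]; exact hxn)
  have hget : ∀ t < (c.disk (P.outStart + j₀)).length,
      (c.disk (P.outStart + j₀))[t]? = some (source l K (natPerm π) (start j₀ + t)) := fun t ht => by
    have h1 := getElem?_block (fun j => c.disk (P.outStart + j)) hj₀ ht
    have h2 := hstartn j₀ hj₀
    change (P.output c)[start j₀ + t]? = _ at h1
    rw [← h1, hout, List.getElem?_map, List.getElem?_range (by omega)]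
    rfl
  -- An untouched block behind the input is still empty and cannot contain position `x`.
  have hj₀U : P.outStart + j₀ ∈ U := by
    by_contra hcon
    have h1 := run_disk_of_notMem hc (fun h => hcon (hmemU.2 h))
    have h2 : D.length ≤ P.outStart + j₀ := by
      have := hP.1
      rw [← hD, List.length_map] at this
      omega
    simp only [initial, List.getD_eq_getElem?_getD, List.getElem?_eq_none h2,
      Option.getD_none] at h1
    simp only [h1, List.length_nil] at hx2
    omega
  have hout_spec : ∀ (a : Fin T), (out a).1.1 ≤ x → x < (out a).2.1 →
      U[a.1]? = some (P.outStart + j₀) := fun a h1 h2 => by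
    by_cases ha : ∃ j < P.outLen, U[a.1]? = some (P.outStart + j)
    · simp only [out, ha, dite_true] at h1 h2
      have h3 := ha.choose_spec.2
      suffices ha.choose = j₀ by rwa [this] at h3
      rcases lt_trichotomy ha.choose j₀ with h4 | h4 | h4
      · have := length_flatMap_range_mono (fun j => c.disk (P.outStart + j)) h4
        simp only [start] at h2
        omega
      · exact h4
      · have := length_flatMap_range_mono (fun j => c.disk (P.outStart + j)) h4
        simp only [start] at h1
        omega
    · simp only [out, ha, dite_false] at h2
      simp at h2
  constructor
  · simp only [Code.candidates, Finset.mem_filter, Finset.mem_univ, true_and]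
    have hlt := (hρlt _ hj₀U).trans_le hUT
    have hex : ∃ j < P.outLen, U[ρ (P.outStart + j₀)]? = some (P.outStart + j) :=
      ⟨j₀, hj₀, by rw [List.getElem?_eq_getElem (hρlt _ hj₀U), hρU _ hj₀U]⟩
    have hch : hex.choose = j₀ := by
      have h3 := hex.choose_spec.2
      have h4 := Option.some.inj ((List.getElem?_eq_getElem (hρlt _ hj₀U)).symm.trans h3)
      rw [hρU _ hj₀U] at h4
      omega
    refine ⟨⟨ρ (P.outStart + j₀), hlt⟩, ?_, ?_, ?_⟩
    · simp only [q, out, hex, dite_true, hch]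
      exact hx1
    · simp only [q, out, hex, dite_true, hch]
      exact hx2
    · rw [hfinal _ hj₀U, mem_labels]
      have h1 := hget (x - start j₀) (by simp only [start]; omega)
      rw [Nat.add_sub_cancel' hx1, hx, source_chunk _ j.2 hrl] at h1
      simp only [natPerm, j.2, dite_true] at h1
      exact ⟨List.mem_of_getElem? h1, by simp [q, Nat.mul_add_mod_self_right, Nat.mod_eq_of_lt hrl]⟩
  · have hcand : ∀ k ∈ q.candidates K j,
        k.1 * l + r ∈ labels (fun x => x % l = r) (c.disk (P.outStart + j₀)) := fun k hk => by
      simp only [Code.candidates, Finset.mem_filter, Finset.mem_univ, true_and] at hk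
      obtain ⟨a, h1, h2, h3⟩ := hk
      have h4 := hout_spec a h1 h2
      obtain ⟨h5, h6⟩ := List.getElem?_eq_some_iff.1 h4
      have h7 : ρ (P.outStart + j₀) = a := by
        rw [← h6]; exact hUn.idxOf_getElem _ _
      rw [← hfinal _ hj₀U, h7]
      exact h3
    calc (q.candidates K j).card
        ≤ (labels (fun x => x % l = r) (c.disk (P.outStart + j₀))).card := by
          refine Finset.card_le_card_of_injOn (fun k => k.1 * l + r) hcand ?_
          intro k _ k' _ hkk
          simp only [Nat.add_right_cancel_iff] at hkk
          exact Fin.ext (Nat.eq_of_mul_eq_mul_right (by omega) hkk)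
      -- By `source_mod`, tracked labels sit only at output positions of the same residue, and the
      -- block covers an interval of at most `b` positions.
      _ ≤ (((Finset.Ico (start j₀) (start j₀ + (c.disk (P.outStart + j₀)).length)).filter
            fun y => y % l = r).image (source l K (natPerm π))).card := by
          refine Finset.card_le_card fun y hy => ?_
          rw [mem_labels] at hy
          obtain ⟨t, ht, hty⟩ := List.mem_iff_getElem.1 hy.1
          have h1 := hget t ht
          rw [List.getElem?_eq_getElem ht, hty] at h1
          have h2 := Option.some.inj h1
          refine Finset.mem_image.2 ⟨start j₀ + t, ?_, h2.symm⟩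
          rw [Finset.mem_filter, Finset.mem_Ico]
          exact ⟨⟨by omega, by omega⟩, by rw [← source_mod l K (natPerm π), ← h2]; exact hy.2⟩
      _ ≤ _ := Finset.card_image_le
      _ ≤ _ := card_filter_mod_le hl _ _ _
      _ ≤ b / l + 1 := by
          rw [Nat.add_sub_cancel_left]
          exact Nat.add_le_add_right (Nat.div_le_div_right (hdisk _)) 1

theorem factorial_le_of_decodes {α : Type} {a₀ a₁ : α} (ha : a₀ ≠ a₁) {n l K m b T : ℕ}
    (hl : 1 ≤ l) (hm : 0 < m) (hb : 0 < b) (h : K * l + K * l ≤ n) (w₀ : ℕ → α)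
    (H : ∀ π : Equiv.Perm (Fin K), ∃ (L : List ℕ) (P : Program),
      IsLayout b (chunkFactorization n l K (natPerm π) w₀) L ∧
      Decodes m b P (chunkFactorization n l K (natPerm π) w₀) L ∧ ioCount P.ops ≤ T) :
    K.factorial ≤ (l * ((T + 1) * ((2 * T) ^ T * (((n + 1) * (n + 1)) ^ T * (((n + 1) * (n + 1)) ^ T
      * Fintype.card {s : Finset (Fin (4 * m * T / l)) // s.card ≤ 2 * b * T / l}))))) *
        (b / l + 1) ^ K := by
  have h1 := factorial_le_of_candidates
    (fun (q : Code n l T (4 * m * T / l) (2 * b * T / l)) j => q.candidates K j) fun π => by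
      obtain ⟨L, P, hL, hP, hT⟩ := H π
      exact exists_code ha hl hm hb h π w₀ hL hP hT
  simpa only [Code, Fintype.card_prod, Fintype.card_fun, Fintype.card_fin, Fintype.card_bool]
    using h1

/-! ### The output bound -/

/-- Writing the output takes one I/O per block. -/
theorem le_mul_ioCount {α : Type} {F : List (Phrase α)} {X : List α} {m b : ℕ} {P : Program}
    {L : List ℕ} (hX : IsFactorization F X) (hL : IsLayout b F L) (hP : Decodes m b P F L) :
    X.length ≤ ioCount P.ops * b := by
  classical
  have hsplit : ∀ (L : List ℕ) (Y : List α), L.sum = Y.length →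
      ∃ D : List (List α), D.map List.length = L ∧ D.flatten = Y := fun L => by
    induction L with
    | nil => intro Y hY; exact ⟨[], rfl, (List.length_eq_zero_iff.1 hY.symm).symm⟩
    | cons k L ih =>
      intro Y hY
      rw [List.sum_cons] at hY
      obtain ⟨D, h1, h2⟩ := ih (Y.drop k) (by rw [List.length_drop]; omega)
      exact ⟨Y.take k :: D, by simp [h1]; omega, by simp [h2]⟩
  obtain ⟨D, hD, hDf⟩ := hsplit L (literals F) hL.2
  obtain ⟨c, hc, hout⟩ := hP.2 F X rfl hX D hD hDf
  have hdisk : ∀ i, (c.disk i).length ≤ b := run_disk_length_le hc fun i => by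
    simp only [initial, List.getD_eq_getElem?_getD]
    cases hi : D[i]? with
    | none => simp
    | some x =>
      refine hL.1 _ ?_
      rw [← hD]
      exact List.mem_map_of_mem (List.mem_of_getElem? hi)
  have hlen : X.length = ∑ j ∈ Finset.range P.outLen, (c.disk (P.outStart + j)).length := by
    rw [← hout, Program.output, List.length_flatMap]
    rfl
  have hzero : ∀ j, P.outStart + j ∉ addrs P.ops → (c.disk (P.outStart + j)).length = 0 :=
    fun j hj => by
      have h2 : D.length ≤ P.outStart + j := by
        have := hP.1
        rw [← hD, List.length_map] at this
        omega
      rw [run_disk_of_notMem hc hj]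
      simp [initial, List.getD_eq_getElem?_getD, List.getElem?_eq_none h2]
  rw [hlen, ← Finset.sum_filter_of_ne (p := fun j => P.outStart + j ∈ addrs P.ops)
    fun j _ hj => by_contra fun hcon => hj (hzero j hcon)]
  refine (Finset.sum_le_card_nsmul _ _ b fun j _ => hdisk _).trans ?_
  rw [smul_eq_mul]
  refine Nat.mul_le_mul_right _ ?_
  rw [← length_addrs]
  refine le_trans ?_ (List.toFinset_card_le _)
  refine Finset.card_le_card_of_injOn (fun j => P.outStart + j) (fun j hj => ?_)
    fun j _ k _ hjk => Nat.add_left_cancel hjk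
  simp only [Finset.coe_filter, Set.mem_ofPred_eq] at hj
  simpa using hj.2

/-! ### From the counting inequality to logarithms -/

/-- Few bits of a string of length `R` are set in few ways. -/
theorem card_finset_card_le {R A : ℕ} {x : ℝ} (hx : 0 < x) (hx1 : x ≤ 1) :
    (Fintype.card {s : Finset (Fin R) // s.card ≤ A} : ℝ) * x ^ A ≤ (1 + x) ^ R := by
  classical
  rw [Fintype.card_subtype]
  have h1 : ∑ s : Finset (Fin R), x ^ s.card = (1 + x) ^ R := by
    have := Fintype.sum_pow_mul_eq_add_pow (Fin R) x 1
    simpa [add_comm] using this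
  rw [← h1, ← nsmul_eq_mul]
  refine (Finset.card_nsmul_le_sum _ (fun s : Finset (Fin R) => x ^ s.card) (x ^ A)
    fun s hs => ?_).trans ?_
  · exact pow_le_pow_of_le_one hx.le hx1 (by simpa using hs)
  · exact Finset.sum_le_sum_of_subset_of_nonneg (Finset.subset_univ _)
      fun s _ _ => by positivity

open Real in
/-- The tall cache condition makes `log n` bits per I/O negligible. -/
theorem log_le_mul_of_le {β : ℝ} (hβ : 0 < β) {n M B : ℕ} (hn : 1 ≤ n) (hB : 1 ≤ B)
    (hM : 2 * B ≤ M) (h : β * log ((n : ℝ) / B) ≤ B * log ((M : ℝ) / B)) :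
    log n ≤ (2 / β + 2 / log 2) * (B * log ((M : ℝ) / B)) := by
  have hB' : (1 : ℝ) ≤ B := by exact_mod_cast hB
  have hn' : (1 : ℝ) ≤ n := by exact_mod_cast hn
  have hM' : (2 : ℝ) * B ≤ M := by exact_mod_cast hM
  have hl2 : 0 < log 2 := log_pos (by norm_num)
  have hlam : log 2 ≤ log ((M : ℝ) / B) :=
    log_le_log (by norm_num) ((le_div_iff₀ (by linarith)).2 hM')
  have hH : B * log 2 ≤ B * log ((M : ℝ) / B) := mul_le_mul_of_nonneg_left hlam (by linarith)
  have hH0 : 0 ≤ B * log ((M : ℝ) / B) := le_trans (by positivity) hH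
  rw [add_mul]
  -- If `B ≤ √n`, then `log (n / B) ≥ log n / 2` and the hypothesis applies. Otherwise `log n ≤ 2 *
  -- log B ≤ 2 * B`, and `log (M / B) ≥ log 2`.
  rcases le_total (2 * log B) (log n) with h1 | h1
  · rw [log_div (by linarith) (by linarith)] at h
    have h2 : log n ≤ 2 / β * (B * log ((M : ℝ) / B)) := by
      rw [div_mul_eq_mul_div, le_div_iff₀ hβ]
      nlinarith
    have : 0 ≤ 2 / log 2 * (B * log ((M : ℝ) / B)) := by positivity
    linarith
  · have h3 : log B ≤ B := (log_le_sub_one_of_pos (by linarith)).trans (by linarith)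
    have h2 : log n ≤ 2 / log 2 * (B * log ((M : ℝ) / B)) := by
      rw [div_mul_eq_mul_div, le_div_iff₀ hl2]
      nlinarith
    have : 0 ≤ 2 / β * (B * log ((M : ℝ) / B)) := by positivity
    linarith

open Real in
theorem mul_log_le_of_factorial_le {K l T n A R g N : ℕ} {x : ℝ} (hx : 0 < x)
    (hK : 1 ≤ K) (hg : 1 ≤ g) (hT : 1 ≤ T) (hn : 2 ≤ n) (hln : l ≤ n) (hTn : 2 * T ≤ n ^ 4)
    (hN : (N : ℝ) * x ^ A ≤ (1 + x) ^ R)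
    (h : K.factorial ≤ (l * ((T + 1) * ((2 * T) ^ T * (((n + 1) * (n + 1)) ^ T *
      (((n + 1) * (n + 1)) ^ T * N))))) * g ^ K) :
    K * (log K - 1 - log g) ≤ 17 * T * log n + A * log x⁻¹ + R * x := by
  have hK' : (0 : ℝ) < K := by exact_mod_cast hK
  have hg' : (0 : ℝ) < g := by exact_mod_cast hg
  have hn' : (0 : ℝ) < n := by exact_mod_cast (show 0 < n by omega)
  have h1 : (n + 1) * (n + 1) ≤ n ^ 4 := by
    have : n + 1 ≤ n ^ 2 := by nlinarith
    calc (n + 1) * (n + 1) ≤ n ^ 2 * n ^ 2 := Nat.mul_le_mul this this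
      _ = n ^ 4 := by ring
  have h2 : K.factorial ≤ n ^ (17 * T) * N * g ^ K := by
    refine h.trans (Nat.mul_le_mul_right _ ?_)
    -- The factor `l` contributes exponent 1, `T + 1 ≤ 2 * T` contributes 4, and each of the three
    -- `T`-th powers has base at most `n ^ 4`. As `T ≥ 1`, `5 + 12 * T ≤ 17 * T`.
    calc l * ((T + 1) * ((2 * T) ^ T * (((n + 1) * (n + 1)) ^ T * (((n + 1) * (n + 1)) ^ T * N))))
        ≤ n * (n ^ 4 * ((n ^ 4) ^ T * ((n ^ 4) ^ T * ((n ^ 4) ^ T * N)))) := by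
          gcongr
          omega
      _ = n ^ (5 + 12 * T) * N := by ring
      _ ≤ n ^ (17 * T) * N := by
          gcongr
          · omega
          · omega
  have h3 : (K : ℝ) ^ K ≤ exp K * K.factorial := by
    have := pow_div_factorial_le_exp (K : ℝ) hK'.le K
    rwa [div_le_iff₀ (by positivity)] at this
  have h4 : (N : ℝ) ≤ exp (A * log x⁻¹ + R * x) := by
    have h5 : (1 + x) ^ R ≤ exp (R * x) := by
      rw [exp_nat_mul]
      exact pow_le_pow_left₀ (by positivity) (by linarith [add_one_le_exp x]) R
    rw [exp_add, exp_nat_mul, exp_log (by positivity), inv_pow, ← div_eq_inv_mul,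
      le_div_iff₀ (by positivity)]
    exact hN.trans h5
  have h6 : (K : ℝ) ^ K ≤ exp K * (n ^ (17 * T) * exp (A * log x⁻¹ + R * x) * g ^ K) := by
    refine h3.trans (mul_le_mul_of_nonneg_left ?_ (exp_pos _).le)
    calc (K.factorial : ℝ) ≤ (n : ℝ) ^ (17 * T) * N * (g : ℝ) ^ K := by exact_mod_cast h2
      _ ≤ _ := by gcongr
  have h7 := log_le_log (by positivity) h6
  rw [log_pow, log_mul (by positivity) (by positivity), log_exp,
    log_mul (by positivity) (by positivity), log_mul (by positivity) (by positivity), log_pow,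
    log_exp, log_pow] at h7
  push_cast at h7
  nlinarith

-- With chunks of length proportional to `Λ`, the symbol capacities divided by `l` become `O(B)` and
-- `O(M)`, so every term on the right of `hbound` is `O(T * B * lam)`. On the left, `K / g` is at
-- least `N / c₁`, and `hQ` lets half of `log N` absorb the constants.
open Real in
theorem mul_log_le_of_bounds {ω κ a Λ c₁ c₃ c₄ N lam : ℝ} {n l K T b m M B : ℕ} (hω : 0 < ω)
    (hκ0 : 0 < κ) (ha : 0 < a) (hΛ0 : 0 < Λ)
    (hc₁ : c₁ = 4 * (κ + a) * (ω / κ + 1))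
    (hc₄ : c₄ = 17 * c₃ + 2 * (ω / κ) + 4 * (ω / κ) / log 2) (hQ : 2 * (1 + log c₁) ≤ log N)
    (hn0 : (0 : ℝ) < n) (hl0 : (0 : ℝ) < l) (hK1 : 1 ≤ K) (hT1 : 1 ≤ T) (hB0 : (0 : ℝ) < B)
    (hM0 : (0 : ℝ) < M) (hlκ : κ * Λ ≤ l) (hlκa : (l : ℝ) ≤ (κ + a) * Λ)
    (hnK : (n : ℝ) ≤ 4 * l * K) (hbB : (b : ℝ) ≤ B * (ω * Λ)) (hmM : (m : ℝ) ≤ M * (ω * Λ))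
    (hN : N = n / (B * Λ)) (hlogN0 : 0 < log N) (hlam2 : log 2 ≤ lam)
    (hlogn3 : log n ≤ c₃ * (B * lam)) (hB1 : (1 : ℝ) ≤ B)
    (hbound : K * (log K - 1 - log ((b / l + 1 : ℕ) : ℝ)) ≤ 17 * T * log n
      + ((2 * b * T / l : ℕ) : ℝ) * lam + ((4 * m * T / l : ℕ) : ℝ) * (B / M)) :
    B * N * (log N / 2) ≤ 4 * (κ + a) * (c₄ * (T * (B * lam))) := by
  have hl2 : 0 < log 2 := log_pos (by norm_num)
  have hlam0 : 0 < lam := hl2.trans_le hlam2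
  have hc₁0 : 0 < c₁ := by rw [hc₁]; positivity
  have hN0 : 0 < N := by rw [hN]; positivity
  have hx0 : (0 : ℝ) < B / M := by positivity
  have hT0 : (0 : ℝ) < T := by exact_mod_cast hT1
  have hΛl : Λ / l ≤ 1 / κ := by
    rw [div_le_div_iff₀ hl0 hκ0]; linarith
  have hA : ((2 * b * T / l : ℕ) : ℝ) ≤ 2 * (ω / κ) * (T * B) := by
    refine Nat.cast_div_le.trans ?_
    push_cast
    calc (2 * b * T / l : ℝ) ≤ 2 * (B * (ω * Λ)) * T / l := by gcongr
      _ = 2 * ω * (T * B) * (Λ / l) := by ring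
      _ ≤ 2 * ω * (T * B) * (1 / κ) := by gcongr
      _ = _ := by ring
  have hR : ((4 * m * T / l : ℕ) : ℝ) * (B / M) ≤ 4 * (ω / κ) * (T * B) := by
    have h1 : ((4 * m * T / l : ℕ) : ℝ) ≤ 4 * (ω / κ) * (T * M) := by
      refine Nat.cast_div_le.trans ?_
      push_cast
      calc (4 * m * T / l : ℝ) ≤ 4 * (M * (ω * Λ)) * T / l := by gcongr
        _ = 4 * ω * (T * M) * (Λ / l) := by ring
        _ ≤ 4 * ω * (T * M) * (1 / κ) := by gcongr
        _ = _ := by ring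
    calc _ ≤ 4 * (ω / κ) * (T * M) * (B / M) := mul_le_mul_of_nonneg_right h1 hx0.le
      _ = _ := by field_simp
  have hright : 17 * T * log n + ((2 * b * T / l : ℕ) : ℝ) * lam
      + ((4 * m * T / l : ℕ) : ℝ) * (B / M) ≤ c₄ * (T * (B * lam)) := by
    have h1 : 17 * T * log n ≤ 17 * c₃ * (T * (B * lam)) := by
      calc 17 * T * log n ≤ 17 * T * (c₃ * (B * lam)) := by gcongr
        _ = _ := by ring
    have h2 : ((2 * b * T / l : ℕ) : ℝ) * lam ≤ 2 * (ω / κ) * (T * (B * lam)) := by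
      calc _ ≤ 2 * (ω / κ) * (T * B) * lam := mul_le_mul_of_nonneg_right hA hlam0.le
        _ = _ := by ring
    have h3 : 4 * (ω / κ) * (T * B) ≤ 4 * (ω / κ) / log 2 * (T * (B * lam)) := by
      rw [div_mul_eq_mul_div, le_div_iff₀ hl2]
      calc 4 * (ω / κ) * (T * B) * log 2 ≤ 4 * (ω / κ) * (T * B) * lam := by gcongr
        _ = _ := by ring
    rw [hc₄, add_mul, add_mul]
    linarith
  have hKN : B * N ≤ 4 * (κ + a) * K := by
    have h1 : B * N = n / Λ := by rw [hN]; field_simp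
    rw [h1, div_le_iff₀ hΛ0]
    calc (n : ℝ) ≤ 4 * l * K := hnK
      _ ≤ 4 * ((κ + a) * Λ) * K := by gcongr
      _ = _ := by ring
  have hg : ((b / l + 1 : ℕ) : ℝ) ≤ (ω / κ + 1) * B := by
    push_cast
    have h1 : ((b / l : ℕ) : ℝ) ≤ ω / κ * B := by
      refine Nat.cast_div_le.trans ?_
      calc (b / l : ℝ) ≤ B * (ω * Λ) / l := by gcongr
        _ = ω * B * (Λ / l) := by ring
        _ ≤ ω * B * (1 / κ) := by gcongr
        _ = _ := by ring
    linarith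
  have hleft : log N / 2 ≤ log K - 1 - log ((b / l + 1 : ℕ) : ℝ) := by
    have hK0 : (0 : ℝ) < K := by exact_mod_cast hK1
    have hg0 : (0 : ℝ) < ((b / l + 1 : ℕ) : ℝ) := by positivity
    have h1 : N * ((b / l + 1 : ℕ) : ℝ) ≤ c₁ * K := by
      calc N * ((b / l + 1 : ℕ) : ℝ) ≤ N * ((ω / κ + 1) * B) := by gcongr
        _ = (ω / κ + 1) * (B * N) := by ring
        _ ≤ (ω / κ + 1) * (4 * (κ + a) * K) := by gcongr
        _ = c₁ * K := by rw [hc₁]; ring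
    have h2 := log_le_log (by positivity) h1
    rw [log_mul hN0.ne' hg0.ne', log_mul hc₁0.ne' hK0.ne'] at h2
    linarith
  calc B * N * (log N / 2) ≤ 4 * (κ + a) * K * (log N / 2) := by gcongr
    _ = 4 * (κ + a) * (K * (log N / 2)) := by ring
    _ ≤ 4 * (κ + a) * (K * (log K - 1 - log ((b / l + 1 : ℕ) : ℝ))) := by gcongr
    _ ≤ 4 * (κ + a) * (c₄ * (T * (B * lam))) := by
        exact mul_le_mul_of_nonneg_left (hbound.trans hright) (by positivity)

-- Block indices range over `T` values; this crude polynomial bound lets them be charged `O(log n)`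
-- each.
open Real in
theorem two_mul_le_pow_four {a N lam : ℝ} {n T : ℕ} (hna : 2 * a ≤ n) (hN0 : 0 < N)
    (hNn : N ≤ a * n) (hlam : log 2 ≤ lam) (hT : (T : ℝ) ≤ N * (log N / lam)) :
    2 * T ≤ n ^ 4 := by
  have hlam0 : 1 / 2 ≤ lam := by linarith [log_two_gt_d9]
  have h1 : log N / lam ≤ 2 * N := by
    rw [div_le_iff₀ (by linarith)]
    have := log_le_sub_one_of_pos hN0
    nlinarith
  have h2 : (T : ℝ) ≤ N * (2 * N) := hT.trans (mul_le_mul_of_nonneg_left h1 hN0.le)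
  have h3 : 2 * N ≤ (n : ℝ) * n := by nlinarith [Nat.cast_nonneg (α := ℝ) n]
  have h4 : (2 * N) * (2 * N) ≤ (n * n) * (n * n) := by gcongr
  have : (2 : ℝ) * T ≤ (n : ℝ) ^ 4 := by
    calc (2 : ℝ) * T ≤ 2 * N * (2 * N) := by linarith
      _ ≤ _ := h4
      _ = _ := by ring
  exact_mod_cast this

end LZDecoding

/-! ### Choice of the constants and the final contradiction -/

open Real LZDecoding in
theorem theorem1 (ω a C β : ℝ) (hω : 0 < ω) (ha : 0 < a) (hC : 0 < C) (hβ : 0 < β) :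
    ∃ c : ℝ, 0 < c ∧ ∃ n₀ : ℕ, ∀ n σ M B : ℕ,
      n₀ ≤ n → 2 ≤ σ → (σ : ℝ) ≤ (n : ℝ) ^ a → 1 ≤ B → 2 * B ≤ M →
      β * Real.log ((n : ℝ) / B) ≤ B * Real.log ((M : ℝ) / B) →
      ∃ (X : List (Fin σ)) (F : List (LZDecoding.Phrase (Fin σ))),
        LZDecoding.IsLZ77Type C n σ F X ∧
        ∀ (L : List ℕ) (P : LZDecoding.Program),
          LZDecoding.IsLayout (LZDecoding.symbolCapacity ω n σ B) F L →
          LZDecoding.Decodes (LZDecoding.symbolCapacity ω n σ M)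
            (LZDecoding.symbolCapacity ω n σ B) P F L →
          c * ((n : ℝ) / (B * Real.logb σ n) *
              Real.logb ((M : ℝ) / B) ((n : ℝ) / (B * Real.logb σ n)))
            ≤ (LZDecoding.ioCount P.ops : ℝ) := by
  have hl2 : 0 < log 2 := log_pos (by norm_num)
  -- Chunks of length at least `Λ / C` keep the number of repeat phrases within `C * n / Λ`.
  obtain ⟨κ, hκ⟩ : ∃ κ : ℝ, κ = 1 / C := ⟨_, rfl⟩
  have hκ0 : 0 < κ := by rw [hκ]; positivity
  obtain ⟨c₁, hc₁⟩ : ∃ c : ℝ, c = 4 * (κ + a) * (ω / κ + 1) := ⟨_, rfl⟩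
  have hc₁0 : 0 < c₁ := by rw [hc₁]; positivity
  obtain ⟨c₃, hc₃⟩ : ∃ c : ℝ, c = 2 / β + 2 / log 2 := ⟨_, rfl⟩
  have hc₃0 : 0 < c₃ := by rw [hc₃]; positivity
  obtain ⟨c₄, hc₄⟩ : ∃ c : ℝ, c = 17 * c₃ + 2 * (ω / κ) + 4 * (ω / κ) / log 2 := ⟨_, rfl⟩
  have hc₄0 : 0 < c₄ := by rw [hc₄]; positivity
  obtain ⟨Q, hQ⟩ : ∃ Q : ℝ, Q = max (2 * (1 + log c₁)) 1 := ⟨_, rfl⟩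
  have hQ1 : 1 ≤ Q := by rw [hQ]; exact le_max_right _ _
  have hQ2 : 2 * (1 + log c₁) ≤ Q := by rw [hQ]; exact le_max_left _ _
  -- The three terms serve, in turn, the polynomial bound on `T`, the range `log N ≤ Q` settled by
  -- the output bound, and the final contradiction.
  obtain ⟨c, hc⟩ : ∃ c : ℝ, c = min 1 (min (log 2 / (ω * Q)) (1 / (16 * (κ + a) * c₄))) :=
    ⟨_, rfl⟩
  have hcpos : 0 < c := by
    rw [hc]; refine lt_min one_pos (lt_min ?_ ?_) <;> positivity
  have hc1 : c ≤ 1 := by rw [hc]; exact min_le_left _ _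
  have hc2 : c ≤ log 2 / (ω * Q) := by
    rw [hc]; exact (min_le_right _ _).trans (min_le_left _ _)
  have hc3 : c ≤ 1 / (16 * (κ + a) * c₄) := by
    rw [hc]; exact (min_le_right _ _).trans (min_le_right _ _)
  obtain ⟨n₁, hn₁⟩ : ∃ n₁ : ℕ, ∀ n : ℕ, n₁ ≤ n → log n ≤ log 2 / (4 * κ) * n := by
    have h := (isLittleO_log_id_atTop.comp_tendsto tendsto_natCast_atTop_atTop).def
      (show 0 < log 2 / (4 * κ) by positivity)
    obtain ⟨n₁, h⟩ := Filter.eventually_atTop.1 h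
    refine ⟨n₁, fun n hn => (le_abs_self _).trans ?_⟩
    simpa using h n hn
  refine ⟨c, hcpos, max n₁ (max 4 ⌈2 * a⌉₊), fun n σ M B hn hσ hσn hB hM hcond => ?_⟩
  have hn4 : 4 ≤ n := (le_max_left _ _).trans ((le_max_right _ _).trans hn)
  have hna : 2 * a ≤ n := (Nat.le_ceil _).trans
    (by exact_mod_cast (le_max_right _ _).trans ((le_max_right _ _).trans hn))
  have hlogn := hn₁ n ((le_max_left _ _).trans hn)
  have hn4' : (4 : ℝ) ≤ n := by exact_mod_cast hn4
  have hn0 : (0 : ℝ) < n := by linarith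
  have hB1 : (1 : ℝ) ≤ B := by exact_mod_cast hB
  have hB0 : (0 : ℝ) < B := by linarith
  have hM2 : (2 : ℝ) * B ≤ M := by exact_mod_cast hM
  have hM0 : (0 : ℝ) < M := by linarith
  have hσ2 : (2 : ℝ) ≤ σ := by exact_mod_cast hσ
  have hlogn0 : 0 < log n := log_pos (by linarith)
  have hlogσ : log 2 ≤ log σ := log_le_log (by norm_num) hσ2
  have hlogσ0 : 0 < log σ := hl2.trans_le hlogσ
  -- symbols per word
  obtain ⟨Λ, hΛ⟩ : ∃ Λ : ℝ, Λ = logb σ n := ⟨_, rfl⟩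
  have hΛ' : Λ = log n / log σ := hΛ
  have hΛ0 : 0 < Λ := by rw [hΛ']; positivity
  -- This is where `σ ≤ n ^ a` enters: rounding `l` up costs only a constant factor.
  have haΛ : 1 ≤ a * Λ := by
    have h1 := log_le_log (by linarith) hσn
    rw [log_rpow hn0] at h1
    rw [hΛ', ← mul_div_assoc, le_div_iff₀ hlogσ0]
    linarith
  have hΛle : κ * Λ ≤ n / 4 := by
    have h1 : Λ ≤ log n / log 2 := by
      rw [hΛ']; exact div_le_div_of_nonneg_left hlogn0.le hl2 hlogσ
    have h2 : log n / log 2 ≤ n / (4 * κ) := by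
      rw [div_le_iff₀ hl2]
      calc log n ≤ _ := hlogn
        _ = _ := by ring
    calc κ * Λ ≤ κ * (n / (4 * κ)) := mul_le_mul_of_nonneg_left (h1.trans h2) hκ0.le
      _ = n / 4 := by field_simp
  -- length and number of the chunks
  obtain ⟨l, hl⟩ : ∃ l : ℕ, l = ⌈κ * Λ⌉₊ := ⟨_, rfl⟩
  have hl1 : 1 ≤ l := by rw [hl]; exact Nat.ceil_pos.2 (by positivity)
  have hl0 : (0 : ℝ) < l := by exact_mod_cast hl1
  have hlκ : κ * Λ ≤ l := by rw [hl]; exact Nat.le_ceil _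
  have hlκ1 : (l : ℝ) ≤ κ * Λ + 1 := by rw [hl]; exact (Nat.ceil_lt_add_one (by positivity)).le
  have hlκa : (l : ℝ) ≤ (κ + a) * Λ := by linarith
  have hln : 2 * l ≤ n := by
    have : (2 : ℝ) * l ≤ n := by linarith
    exact_mod_cast this
  obtain ⟨K, hK⟩ : ∃ K : ℕ, K = n / (2 * l) := ⟨_, rfl⟩
  have hK1 : 1 ≤ K := by rw [hK]; exact Nat.div_pos hln (by omega)
  have hKn : K * l + K * l ≤ n := by
    have := Nat.div_mul_le_self n (2 * l)
    rw [← hK] at this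
    linarith
  have hnK : (n : ℝ) ≤ 4 * l * K := by
    have h1 : n < 2 * l * (K + 1) := by rw [hK]; exact Nat.lt_mul_div_succ n (by omega)
    have h2 : 2 * l * (K + 1) ≤ 4 * l * K := by nlinarith
    exact_mod_cast h1.le.trans h2
  have hrep : (K : ℝ) ≤ C * (n / logb σ n) := by
    rw [← hΛ, ← mul_div_assoc, le_div_iff₀ hΛ0]
    have h1 : (K : ℝ) * l ≤ n := by exact_mod_cast (by omega : K * l ≤ n)
    have h2 : (K : ℝ) * (κ * Λ) ≤ n := (mul_le_mul_of_nonneg_left hlκ (by positivity)).trans h1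
    calc (K : ℝ) * Λ = C * (K * (κ * Λ)) := by rw [hκ]; field_simp
      _ ≤ C * n := mul_le_mul_of_nonneg_left h2 hC.le
  by_contra! hcon
  let w₀ : ℕ → Fin σ := fun _ => ⟨0, by omega⟩
  rw [← hΛ] at hcon
  obtain ⟨b, hb⟩ : ∃ b, b = symbolCapacity ω n σ B := ⟨_, rfl⟩
  obtain ⟨m, hm⟩ : ∃ m, m = symbolCapacity ω n σ M := ⟨_, rfl⟩
  rw [← hb, ← hm] at hcon
  have hbB : (b : ℝ) ≤ B * (ω * Λ) := by
    rw [hb, symbolCapacity, ← hΛ]; exact Nat.floor_le (by positivity)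
  have hmM : (m : ℝ) ≤ M * (ω * Λ) := by
    rw [hm, symbolCapacity, ← hΛ]; exact Nat.floor_le (by positivity)
  have hbm : b ≤ m := by
    rw [hb, hm, symbolCapacity, symbolCapacity, ← hΛ]
    refine Nat.floor_le_floor (mul_le_mul_of_nonneg_right ?_ (by positivity))
    linarith
  obtain ⟨N, hN⟩ : ∃ N : ℝ, N = n / (B * Λ) := ⟨_, rfl⟩
  have hN0 : 0 < N := by rw [hN]; positivity
  obtain ⟨lam, hlam⟩ : ∃ lam : ℝ, lam = log ((M : ℝ) / B) := ⟨_, rfl⟩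
  have hlam2 : log 2 ≤ lam := by
    rw [hlam]; exact log_le_log (by norm_num) ((le_div_iff₀ hB0).2 hM2)
  have hlam0 : 0 < lam := hl2.trans_le hlam2
  have hlogb : logb ((M : ℝ) / B) N = log N / lam := by rw [hlam]; rfl
  rw [← hN, hlogb] at hcon
  have hall : ∀ τ : Equiv.Perm (Fin K), ∃ (L : List ℕ) (P : Program),
      IsLayout b (chunkFactorization n l K (natPerm τ) w₀) L ∧
      Decodes m b P (chunkFactorization n l K (natPerm τ) w₀) L ∧
      (ioCount P.ops : ℝ) < c * (N * (log N / lam)) := fun τ => by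
    obtain ⟨L, P, h1, h2, h3⟩ := hcon _ _ ⟨by simp [chunkString],
      isFactorization_chunk hl1 hKn (natPerm_lt τ) w₀, by
        rw [numRep_chunkFactorization]; exact hrep⟩
    exact ⟨L, P, h1, h2, h3⟩
  -- the trivial bound
  obtain ⟨hb0, hNio, hio1⟩ : 0 < b ∧ N / ω < c * (N * (log N / lam)) ∧
      1 ≤ c * (N * (log N / lam)) := by
    obtain ⟨L, P, h1, h2, h3⟩ := hall 1
    have h4 := le_mul_ioCount (isFactorization_chunk hl1 hKn (natPerm_lt 1) w₀) h1 h2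
    rw [show (chunkString n l K (natPerm 1) w₀).length = n by simp [chunkString]] at h4
    have hb0 : 0 < b := by
      rcases Nat.eq_zero_or_pos b with h | h
      · rw [h, mul_zero] at h4; omega
      · exact h
    have hio : 1 ≤ ioCount P.ops := by
      rcases Nat.eq_zero_or_pos (ioCount P.ops) with h | h
      · rw [h, zero_mul] at h4; omega
      · exact h
    have h5 : (n : ℝ) ≤ ioCount P.ops * (B * (ω * Λ)) :=
      (show (n : ℝ) ≤ ioCount P.ops * b by exact_mod_cast h4).trans
        (mul_le_mul_of_nonneg_left hbB (by positivity))
    refine ⟨hb0, lt_of_le_of_lt ?_ h3, le_trans (by exact_mod_cast hio) h3.le⟩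
    rw [hN, div_div, div_le_iff₀ (by positivity)]
    linarith
  -- A decoder cheaper than claimed still has to write the output, which is possible only if `log N`
  -- is large.
  have hlogN : Q < log N := by
    have h1 : 1 / ω < c * (log N / lam) := by
      have : N * (1 / ω) < N * (c * (log N / lam)) := by
        calc N * (1 / ω) = N / ω := by ring
          _ < _ := hNio
          _ = _ := by ring
      exact lt_of_mul_lt_mul_left this hN0.le
    have h2 : lam / ω < c * log N := by
      have := mul_lt_mul_of_pos_right h1 hlam0
      calc lam / ω = 1 / ω * lam := by ring
        _ < _ := this
        _ = c * log N := by field_simp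
    have h3 : c * Q ≤ lam / ω := by
      rw [le_div_iff₀ hω]
      rw [le_div_iff₀ (by positivity)] at hc2
      linarith
    exact lt_of_mul_lt_mul_left (h3.trans_lt h2) hcpos.le
  have hlogN0 : 0 < log N := by linarith
  -- the counting bound
  obtain ⟨T, hT⟩ : ∃ T : ℕ, T = ⌊c * (N * (log N / lam))⌋₊ := ⟨_, rfl⟩
  have hT1 : 1 ≤ T := by rw [hT]; exact Nat.le_floor (by exact_mod_cast hio1)
  have hTle : (T : ℝ) ≤ c * (N * (log N / lam)) := by
    rw [hT]; exact Nat.floor_le (by linarith)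
  have hNn : N ≤ a * n := by
    rw [hN, div_le_iff₀ (by positivity)]
    have h1 : 1 ≤ B * (a * Λ) := one_le_mul_of_one_le_of_one_le hB1 haΛ
    calc (n : ℝ) = n * 1 := by ring
      _ ≤ n * (B * (a * Λ)) := mul_le_mul_of_nonneg_left h1 hn0.le
      _ = a * n * (B * Λ) := by ring
  have hTn : 2 * T ≤ n ^ 4 := by
    refine two_mul_le_pow_four hna hN0 hNn hlam2 (hTle.trans ?_)
    exact mul_le_of_le_one_left (by positivity) hc1
  have hfac := factorial_le_of_decodes (a₀ := (⟨0, by omega⟩ : Fin σ)) (a₁ := ⟨1, by omega⟩)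
    (by simp) hl1 (T := T) (hb0.trans_le hbm) hb0 hKn w₀ fun τ => by
      obtain ⟨L, P, h1, h2, h3⟩ := hall τ
      exact ⟨L, P, h1, h2, by rw [hT]; exact Nat.le_floor h3.le⟩
  -- The weight `B / M` has the order of the density of ones, so that `A * log (1 / x)` and `R * x`
  -- are both `O(T * B * lam)`.
  have hx0 : (0 : ℝ) < B / M := by positivity
  have hx1 : (B : ℝ) / M ≤ 1 := by rw [div_le_one hM0]; linarith
  have hbound := mul_log_le_of_factorial_le hx0 hK1 (Nat.succ_pos _) hT1 (by omega)
    (by omega) hTn (card_finset_card_le hx0 hx1) hfac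
  rw [inv_div, ← hlam] at hbound
  have hlogn3 : log n ≤ c₃ * (B * lam) := by
    rw [hc₃, hlam]; exact log_le_mul_of_le hβ (by omega) hB hM hcond
  have hfin := mul_log_le_of_bounds hω hκ0 ha hΛ0 hc₁ hc₄ (by linarith) hn0 hl0 hK1 hT1 hB0
    hM0 hlκ hlκa hnK hbB hmM hN hlogN0 hlam2 hlogn3 hB1 hbound
  have hT0 : (0 : ℝ) < T := by exact_mod_cast hT1
  have hTup : 16 * (κ + a) * c₄ * T ≤ N * (log N / lam) := by
    have h1 : 0 ≤ N * (log N / lam) := by positivity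
    rw [le_div_iff₀ (by positivity)] at hc3
    calc 16 * (κ + a) * c₄ * T ≤ 16 * (κ + a) * c₄ * (c * (N * (log N / lam))) := by gcongr
      _ = c * (16 * (κ + a) * c₄) * (N * (log N / lam)) := by ring
      _ ≤ 1 * (N * (log N / lam)) := mul_le_mul_of_nonneg_right hc3 h1
      _ = _ := one_mul _
  have h1 : 16 * (κ + a) * c₄ * T * (B * lam) ≤ B * N * log N := by
    calc 16 * (κ + a) * c₄ * T * (B * lam) ≤ N * (log N / lam) * (B * lam) :=
          mul_le_mul_of_nonneg_right hTup (by positivity)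
      _ = B * N * log N := by field_simp
  have h2 : 0 < B * N * log N := by positivity
  have h3 : 0 < (κ + a) * c₄ * T * (B * lam) := by positivity
  -- `hfin` allows only the factor 8 where `h1` demands 16, and the common quantity is positive.
  linarith
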